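/- All theories are first-order and one-sorted. For a theory $T$ in a language $L$ write $|T|=|L|+\aleph_0$. A \emph{monster model} (of degree $\kappa$) is a structure ${\mathfrak C}$ that is $\kappa$-saturated and strongly $\kappa$-homogeneous, where $\kappa$ is a strong limit cardinal with $\kappa>|T|$; sets and tuples are \emph{small} if they have cardinality less than $\kappa$. For small tuples $a,b$ in ${\mathfrak C}$ let $d_{\mathrm L}(a,b)\le n$ mean that there are $a=a_0,a_1,\ldots,a_n=b$ and elementary submodels $M_1,\ldots,M_n\preceq{\mathfrak C}$ with $a_{i-1}\equiv_{M_i}a_i$ for $i=1,\ldots,n$, and $d_{\mathrm L}(a,b)<\infty$ if this holds for some $n$. A theory is \emph{G-compact} if in its monster models, for every small (possibly infinite) tuple $a$ there is an integer $n$ such that $d_{\mathrm L}(a,b)<\infty$ implies $d_{\mathrm L}(a,b)\le n$ for all $b$. A theory $T$ is \emph{hereditarily G-compact} if for every model $M\models T$ and every structure $N$ interpreted by $M$ (with parameters), $\mathrm{Th}(N)$ is G-compact. Let ${\mathfrak C}\models T$ be a monster model and let $G\subseteq{\mathfrak C}^k$ be a group definable in ${\mathfrak C}$ with parameters in a small set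 $A$. Then $G^{00}_A$ denotes the smallest subgroup of $G$ that is type-definable with parameters in $A$ and has small index (at most $2^{|T|+|A|}$) in $G$, and $G^{000}_A$ denotes the smallest subgroup of $G$ that is invariant under $\mathrm{Aut}({\mathfrak C}/A)$ and has small index (at most $2^{|T|+|A|}$) in $G$. If $G^{00}_A$ (respectively $G^{000}_A$) is the same for all small sets $A$ over which $G$ is definable, one says that $G^{00}$ (respectively $G^{000}$) exists and denotes it so. \textbf{Proposition.} Suppose that $T$ is hereditarily G-compact, ${\mathfrak C}\models T$ is a monster model, $A\subseteq{\mathfrak C}$ is small and $G$ is a group definable in ${\mathfrak C}$ over $A$. Then $G^{00}_A$ and $G^{000}_A$ exist and $G^{00}_A=G^{000}_A$. In particular, if $T$ moreover has NIP, then $G^{00}$ and $G^{000}$ exist and $G^{00}=G^{000}$. -/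

import Mathlib

open FirstOrder Cardinal

universe u v u' v'

namespace HGC

/-! ### Types, monster models, Lascar distance -/

section Lascar

variable (L : FirstOrder.Language.{u, v}) {M : Type (max u v)} [L.Structure M]

/-- The cardinality `|T|` of a theory in the language `L`, i.e. `|L| + ℵ₀`. -/
noncomputable def thCard (L : FirstOrder.Language.{u, v}) : Cardinal.{max u v} := L.card + ℵ₀

/-- `a ≡_B b`: the (possibly infinite) tuples `a` and `b` satisfy the same formulas with
parameters from `B`. -/
def SameTypeOver (B : Set M) {α : Type (max u v)} (a b : α → M) : Prop :=
  ∀ φ : L[[B]].Formula α, φ.Realize a ↔ φ.Realize b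

/-- `M` is `κ`-saturated: over any set of fewer than `κ` parameters, every finitely satisfiable
set of formulas in finitely many variables is realized. -/
def IsSaturated (κ : Cardinal.{max u v}) (M : Type (max u v)) [L.Structure M] : Prop :=
  ∀ (A : Set M), #A < κ → ∀ (n : ℕ) (p : Set (L[[A]].Formula (Fin n))),
    (∀ p₀ : Finset (L[[A]].Formula (Fin n)), (p₀ : Set (L[[A]].Formula (Fin n))) ⊆ p →
      ∃ c : Fin n → M, ∀ φ ∈ p₀, φ.Realize c) →
    ∃ c : Fin n → M, ∀ φ ∈ p, φ.Realize c

/-- `M` is strongly `κ`-homogeneous: tuples of length less than `κ` with the same type are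
conjugate under the automorphism group. -/
def IsStronglyHomogeneous (κ : Cardinal.{max u v}) (M : Type (max u v)) [L.Structure M] : Prop :=
  ∀ (α : Type (max u v)), #α < κ → ∀ a b : α → M,
    (∀ φ : L.Formula α, φ.Realize a ↔ φ.Realize b) →
      ∃ σ : M ≃[L] M, ∀ i, σ (a i) = b i

/-- `C` is a monster model (of its theory), where "small" means "of cardinality less than `κ`":
`κ` is a strong limit cardinal greater than `|T|`, and `C` is `κ`-saturated and strongly
`κ`-homogeneous. -/
structure IsMonster (κ : Cardinal.{max u v}) (C : Type (max u v)) [L.Structure C] : Prop where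
  isStrongLimit : κ.IsStrongLimit
  thCard_lt : thCard L < κ
  saturated : IsSaturated L κ C
  homogeneous : IsStronglyHomogeneous L κ C

/-- The Lascar distance satisfies `d(a, b) ≤ n`: there are `a = c₀, c₁, …, cₙ = b` such that, for
each `i < n`, the tuples `cᵢ` and `cᵢ₊₁` have the same type over some elementary submodel. -/
def LascarDistLE (n : ℕ) {α : Type (max u v)} (a b : α → M) : Prop :=
  ∃ c : ℕ → α → M, c 0 = a ∧ c n = b ∧
    ∀ i < n, ∃ S : L.ElementarySubstructure M, SameTypeOver L (S : Set M) (c i) (c (i + 1))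

/-- `a` and `b` have the same Lascar strong type: their Lascar distance is finite. -/
def LascarEquiv {α : Type (max u v)} (a b : α → M) : Prop :=
  ∃ n : ℕ, LascarDistLE L n a b

variable {L}

/-- The theory `T` is G-compact: in a monster model, the Lascar strong type of every small
(possibly infinite) tuple has finite diameter. -/
def GCompact (T : L.Theory) : Prop :=
  ∀ (κ : Cardinal.{max u v}) (C : Type (max u v)) [L.Structure C] [Nonempty C] [T.Model C],
    IsMonster L κ C → ∀ (α : Type (max u v)), #α < κ → ∀ a : α → C,
      ∃ n : ℕ, ∀ b : α → C, LascarEquiv L a b → LascarDistLE L n a b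

end Lascar

/-! ### Interpretations and hereditary G-compactness -/

/-- The pullback to `Mᵐᵈ` of a relation `R ⊆ Nᵐ` along a partial map `π` from `D ⊆ Mᵈ` to `N`. -/
def pullback {M N : Type*} {d : ℕ} {D : Set (Fin d → M)} (π : D → N) {m : ℕ}
    (R : Set (Fin m → N)) : Set (Fin m × Fin d → M) :=
  {w | ∃ x : Fin m → D, (∀ i j, w (i, j) = (x i : Fin d → M) j) ∧ (fun i => π (x i)) ∈ R}

/-- The `L`-structure `M` interprets the `L'`-structure `N` with parameters: there is a surjection
onto `N` from a definable subset of some power `Mᵈ`, such that the pullbacks of equality, of all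
basic relations and of the graphs of all basic functions of `N` are definable in `M`, where
parameters from `M` are allowed throughout. -/
def Interprets (L : FirstOrder.Language.{u, v}) (M : Type*) [L.Structure M]
    (L' : FirstOrder.Language.{u', v'}) (N : Type*) [L'.Structure N] : Prop :=
  ∃ (d : ℕ) (D : Set (Fin d → M)) (π : D → N),
    (Set.univ : Set M).Definable L D ∧
    Function.Surjective π ∧
    (Set.univ : Set M).Definable L (pullback π {z : Fin 2 → N | z 0 = z 1}) ∧
    (∀ (m : ℕ) (R : L'.Relations m), (Set.univ : Set M).Definable L
      (pullback π {z : Fin m → N | FirstOrder.Language.Structure.RelMap R z})) ∧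
    (∀ (m : ℕ) (f : L'.Functions m), (Set.univ : Set M).Definable L
      (pullback π {z : Fin (m + 1) → N |
        FirstOrder.Language.Structure.funMap f (fun i : Fin m => z i.castSucc) = z (Fin.last m)}))

/-- `T` is hereditarily G-compact: for every model `M` of `T` and every structure `N` interpreted
by `M` with parameters, the theory of `N` is G-compact. -/
def HereditarilyGCompact {L : FirstOrder.Language.{u, v}} (T : L.Theory) : Prop :=
  ∀ (M : Type (max u v)) [L.Structure M] [Nonempty M] [T.Model M]
    (L' : FirstOrder.Language.{max u v, max u v}) (N : Type (max u v)) [L'.Structure N] [Nonempty N],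
    Interprets L M L' N → GCompact (L'.completeTheory N)

/-! ### NIP -/

/-- The formula `φ(x; y)` has the independence property in `M`: it shatters arbitrarily large
finite sets of tuples. -/
def HasIP {L : FirstOrder.Language.{u, v}} (M : Type*) [L.Structure M] {n m : ℕ}
    (φ : L.Formula (Fin n ⊕ Fin m)) : Prop :=
  ∀ k : ℕ, ∃ (a : Fin k → Fin n → M) (b : Set (Fin k) → Fin m → M),
    ∀ (i : Fin k) (S : Set (Fin k)), φ.Realize (Sum.elim (a i) (b S)) ↔ i ∈ S

/-- `T` has NIP: no formula has the independence property in a model of `T`. -/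
def NIP {L : FirstOrder.Language.{u, v}} (T : L.Theory) : Prop :=
  ∀ (M : Type (max u v)) [L.Structure M] [Nonempty M] [T.Model M] (n m : ℕ)
    (φ : L.Formula (Fin n ⊕ Fin m)), ¬ HasIP M φ

/-! ### Definable groups and their connected components -/

section Groups

variable (L : FirstOrder.Language.{u, v}) {C : Type (max u v)} [L.Structure C] {k : ℕ}

/-- The group `G ⊆ Cᵏ` is definable with parameters in `A`: its universe and the graph of its
multiplication are. -/
def IsDefinableGroup (A : Set C) (G : Set (Fin k → C)) [Group G] : Prop :=
  A.Definable L G ∧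
  A.Definable L {w : Fin 3 × Fin k → C | ∃ x y z : G, x * y = z ∧
    ∀ j, w (0, j) = (x : Fin k → C) j ∧ w (1, j) = (y : Fin k → C) j ∧
      w (2, j) = (z : Fin k → C) j}

variable {G : Set (Fin k → C)} [Group G]

/-- `H` has small index in `G`, i.e. index at most `2 ^ (|T| + |A|)`. -/
def HasSmallIndex (A : Set C) (H : Subgroup G) : Prop :=
  #(G ⧸ H) ≤ 2 ^ (thCard L + #A)

/-- `H` is invariant under all automorphisms of `C` that fix `A` pointwise. -/
def IsInvariantOver (A : Set C) (H : Subgroup G) : Prop :=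
  ∀ σ : C ≃[L] C, (∀ a ∈ A, σ a = a) →
    ∀ x ∈ ((↑) '' (H : Set G) : Set (Fin k → C)),
      (fun j => σ (x j)) ∈ ((↑) '' (H : Set G) : Set (Fin k → C))

/-- `H` is type-definable over `A`: it is an intersection of sets definable over `A`. -/
def IsTypeDefinableOver (A : Set C) (H : Subgroup G) : Prop :=
  ∃ F : Set (Set (Fin k → C)), (∀ s ∈ F, A.Definable L s) ∧
    ((↑) '' (H : Set G) : Set (Fin k → C)) = ⋂₀ F

/-- `H = G⁰⁰_A`: the smallest subgroup of `G` of small index that is type-definable over `A`. -/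
def IsG00 (A : Set C) (H : Subgroup G) : Prop :=
  IsLeast {K : Subgroup G | IsTypeDefinableOver L A K ∧ HasSmallIndex L A K} H

/-- `H = G⁰⁰⁰_A`: the smallest subgroup of `G` of small index that is invariant under
`Aut(C/A)`. -/
def IsG000 (A : Set C) (H : Subgroup G) : Prop :=
  IsLeast {K : Subgroup G | IsInvariantOver L A K ∧ HasSmallIndex L A K} H

end Groups

end HGC

namespace HGC

open Set Filter
open scoped Pointwise

/-! ### Definable sets: supports, fibres, automorphisms -/

section Definable

variable {L : FirstOrder.Language.{u, v}}

section

variable {C : Type*} [L.Structure C] {A : Set C}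

/-! Call P thick if, along every ultrafilter, quotients y x⁻¹ of successively chosen elements fall
in P; `core` is the intersection of the thick sets definable over A. If h lies in `core`, no
A-definable set containing h has thick complement, so saturation yields long small sequences whose
quotients x_j x_i⁻¹ (i < j) all realize the type of h over A. By pigeonhole a subgroup of small
index contains such a quotient, and if it is A-invariant it contains h (`core_subset`). Conversely,
finitely many translates of a thick set cover G, which bounds the index of `component`, the subgroup
generated by `core` (`index_component_le`). Hence `component` is G⁰⁰⁰_A for every T.

Hereditary G-compactness makes it type-definable. Equip G with all A-definable relations invariant
under right translation. This torsor is interpreted in C and is again a monster model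
(`isMonster_torsor`), and its translations are automorphisms, so all its points look alike. Lascar
distance at most n from 1 to h forces h ∈ (core · core⁻¹)ⁿ (`LascarDistLE.mem_pow`), while the h
Lascar equivalent to 1 form an invariant subgroup of small index, which therefore contains `core`. A
finite bound n for the diameter gives component = (core · core⁻¹)ⁿ, which is type-definable by
compactness (`isTD_component`). So G⁰⁰_A = G⁰⁰⁰_A.

Under NIP the component does not depend on A. If A ⊆ B and the component H over B were strictly
smaller than the one over A, some B-definable D ⊇ H would omit an element of the core over A. Then
every subgroup of small index leaves D after some automorphism over A, and `exists_shattering` turns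
this into a family of conjugates of one definable set that shatters arbitrarily large finite sets.
-/

theorem _root_.Set.Definable.exists_finset_preimage {α : Type*} {S : Set (α → C)}
    (hS : A.Definable L S) : ∃ (F : Finset α) (S' : Set (F → C)), A.Definable L S' ∧
      ∀ v, v ∈ S ↔ (fun i : F => v i) ∈ S' := by
  classical
  obtain ⟨φ, rfl⟩ := hS
  refine ⟨φ.freeVarFinset, _, ⟨φ.restrictFreeVar id, rfl⟩, fun v => ?_⟩
  exact (FirstOrder.Language.BoundedFormula.realize_restrictFreeVar (φ := φ) (f := id) v
    (fun _ => rfl)).symm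

theorem _root_.Set.Definable.fiber {α β : Type*} {S : Set (α ⊕ β → C)}
    (hS : A.Definable L S) (c : α → C) :
    (A ∪ range c).Definable L {y : β → C | Sum.elim c y ∈ S} := by
  rw [definable_iff_exists_formula_sum] at hS ⊢
  obtain ⟨φ, rfl⟩ := hS
  refine ⟨φ.relabel (Sum.elim (fun a : A => Sum.inl ⟨a.1, Or.inl a.2⟩)
    (Sum.elim (fun i => Sum.inl ⟨c i, Or.inr ⟨i, rfl⟩⟩) Sum.inr)), ?_⟩
  ext y
  simp only [mem_ofPred_eq, FirstOrder.Language.Formula.realize_relabel]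
  refine iff_of_eq (congrArg _ (funext fun x => ?_))
  rcases x with a | i | j <;> rfl

theorem _root_.Set.Definable.mem_iff_of_equiv {α : Type*} {S : Set (α → C)} (hS : A.Definable L S)
    (σ : C ≃[L] C) (hσ : ∀ a ∈ A, σ a = a) (v : α → C) : v ∈ S ↔ (fun i => σ (v i)) ∈ S := by
  rw [definable_iff_exists_formula_sum] at hS
  obtain ⟨φ, rfl⟩ := hS
  simp only [mem_ofPred_eq]
  rw [← FirstOrder.Language.StrongHomClass.realize_formula σ φ]
  refine iff_of_eq (congrArg _ (funext fun x => ?_))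
  rcases x with a | i
  · exact hσ a a.2
  · rfl

end

variable {C : Type (max u v)} [L.Structure C] {A : Set C}

theorem IsStronglyHomogeneous.exists_equiv {κ : Cardinal.{max u v}} (hκ : ℵ₀ ≤ κ)
    (hC : IsStronglyHomogeneous L κ C) (hA : #A < κ) {α : Type (max u v)} (hα : #α < κ)
    {a b : α → C} (h : ∀ S : Set (α → C), A.Definable L S → a ∈ S → b ∈ S) :
    ∃ σ : C ≃[L] C, (∀ x ∈ A, σ x = x) ∧ ∀ i, σ (a i) = b i := by
  have h' : ∀ S : Set (α → C), A.Definable L S → (a ∈ S ↔ b ∈ S) := fun S hS =>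
    ⟨h S hS, fun hb => by_contra fun ha => h _ hS.compl ha hb⟩
  obtain ⟨σ, hσ⟩ := hC (A ⊕ α) (by simpa using add_lt_of_lt hκ hA hα)
    (Sum.elim ((↑) : A → C) a) (Sum.elim (↑) b) fun φ =>
      h' {v | φ.Realize (Sum.elim ((↑) : A → C) v)} (definable_iff_exists_formula_sum.2 ⟨φ, rfl⟩)
  exact ⟨σ, fun x hx => hσ (Sum.inl ⟨x, hx⟩), fun i => hσ (Sum.inr i)⟩

/-! ### Saturation for families of definable sets -/

theorem IsSaturated.nonempty_iInter {κ : Cardinal.{max u v}} (hC : IsSaturated L κ C)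
    (hA : #A < κ) {ι : Type*} [Finite ι] {J : Type*} (f : J → Set (ι → C))
    (hf : ∀ j, A.Definable L (f j)) (hfip : ∀ s : Finset J, ∃ c, ∀ j ∈ s, c ∈ f j) :
    ∃ c, ∀ j, c ∈ f j := by
  classical
  obtain ⟨n, ⟨e⟩⟩ := Finite.exists_equiv_fin ι
  choose φ hφ using hf
  have key : ∀ j (c : Fin n → C), ((φ j).relabel e).Realize c ↔ (c ∘ e) ∈ f j := by
    intro j c
    rw [FirstOrder.Language.Formula.realize_relabel, hφ j]
    rfl
  obtain ⟨c, hc⟩ := hC A hA n (range fun j => (φ j).relabel e) (by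
    intro p₀ hp₀
    rw [← image_univ, Finset.subset_set_image_iff] at hp₀
    obtain ⟨s, -, hs⟩ := hp₀
    obtain ⟨c, hc⟩ := hfip s
    refine ⟨c ∘ e.symm, fun ψ hψ => ?_⟩
    rw [← hs, Finset.mem_image] at hψ
    obtain ⟨j, hj, rfl⟩ := hψ
    rw [key]
    simpa [Function.comp_assoc] using hc j hj)
  exact ⟨c ∘ e, fun j => (key j c).1 (hc _ ⟨j, rfl⟩)⟩

/-- Saturation concerns finitely many variables; this realizes a complete type in fewer than κ
variables, presented as an ultrafilter. The coordinates are chosen by recursion along a well-order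
of I, each realizing the type prescribed over the earlier ones. -/
theorem IsSaturated.exists_mem_of_ultrafilter {κ : Cardinal.{max u v}} (hκ : ℵ₀ ≤ κ)
    (hC : IsSaturated L κ C) (hA : #A < κ) {I : Type (max u v)} (hI : #I < κ)
    (U : Ultrafilter (I → C)) : ∃ c : I → C, ∀ S, A.Definable L S → S ∈ U → c ∈ S := by
  classical
  let _ : LinearOrder I := linearOrderOfSTO WellOrderingRel
  have : WellFoundedLT I := ⟨(WellOrderingRel.isWellOrder (α := I)).wf⟩
  have : Nonempty C ∨ IsEmpty C := (isEmpty_or_nonempty C).symm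
  -- The coordinates of c in s satisfy the part of the type that speaks about s only.
  let Good : Set I → (I → C) → Prop := fun s c => ∀ S : Set (I → C), A.Definable L S → S ∈ U →
    (∀ v w, EqOn v w s → (v ∈ S ↔ w ∈ S)) → c ∈ S
  have good_congr : ∀ s c c', EqOn c c' s → Good s c → Good s c' := fun s c c' h hg S h1 h2 h3 =>
    (h3 c c' h).1 (hg S h1 h2 h3)
  have good_union : ∀ s c, IsLowerSet s → (∀ j ∈ s, Good (Iic j) c) → Good s c := by
    intro s c hs hj S h1 h2 h3
    obtain ⟨F, S', -, hS'⟩ := h1.exists_finset_preimage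
    have hdep : ∀ v w : I → C, (∀ i ∈ F, i ∈ s → v i = w i) → (v ∈ S ↔ w ∈ S) := by
      intro v w hvw
      rw [h3 w (fun i => if i ∈ F then v i else w i), hS', hS']
      · refine iff_of_eq (congrArg (· ∈ S') (funext fun i => ?_))
        simp
      · intro i hi
        by_cases hF : i ∈ F
        · simp [hF, hvw i hF hi]
        · simp [hF]
    -- S depends on finitely many coordinates in s. The largest of them puts S within one initial
    -- segment; if there are none, S is everything.
    by_cases hne : (F.filter (· ∈ s)).Nonempty
    · have hm := (F.filter (· ∈ s)).max'_mem hne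
      set m := (F.filter (· ∈ s)).max' hne
      refine hj m (Finset.mem_filter.1 hm).2 S h1 h2 fun v w hvw => hdep v w fun i hi his => ?_
      exact hvw (Finset.le_max' (F.filter (· ∈ s)) i (Finset.mem_filter.2 ⟨hi, his⟩))
    · obtain ⟨v, hv⟩ := U.nonempty_of_mem h2
      refine (hdep v c fun i hi his => ?_).1 hv
      exact absurd ⟨i, Finset.mem_filter.2 ⟨hi, his⟩⟩ hne
  have step : ∀ i c, Good (Iio i) c → ∃ y, Good (Iic i) (Function.update c i y) := by
    intro i c hc
    have hB : #(A ∪ range c : Set C) < κ :=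
      (mk_union_le _ _).trans_lt (add_lt_of_lt hκ hA (mk_range_le.trans_lt hI))
    let J := {S : Set (I → C) // A.Definable L S ∧ S ∈ U ∧
      ∀ v w, EqOn v w (Iic i) → (v ∈ S ↔ w ∈ S)}
    let r : I → I ⊕ Unit := fun j => if j = i then Sum.inr () else Sum.inl j
    have hr : ∀ (v : I → C) (y : Unit → C), Sum.elim v y ∘ r = Function.update v i (y ()) := by
      intro v y
      funext j
      by_cases h : j = i
      · subst h; simp [r]
      · simp [r, h]
    obtain ⟨y, hy⟩ := hC.nonempty_iInter hB
      (fun S : J => {y : Unit → C | Function.update c i (y ()) ∈ S.1}) (by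
        intro S
        have := (S.2.1.preimage_comp r).fiber c
        simpa only [mem_preimage, hr] using this) (by
        intro s
        have h1 : A.Definable L (⋂ S ∈ s, S.1) :=
          definable_biInter_finset (f := fun S : J => S.1) (fun S => S.2.1) s
        have h2 : (⋂ S ∈ s, S.1) ∈ U := (biInter_finset_mem s).2 fun S _ => S.2.2.1
        -- Projecting away coordinate i leaves a set that depends only on the earlier coordinates,
        -- where `hc` applies.
        have h3 : A.Definable L {v : I → C | ∃ y : Unit → C, Sum.elim v y ∘ r ∈ ⋂ S ∈ s, S.1} :=
          (h1.preimage_comp r).exists_of_finite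
        simp only [hr] at h3
        obtain ⟨y, hy⟩ := hc _ h3 (mem_of_superset h2 fun v hv => ⟨fun _ => v i, by
          simpa using hv⟩) (by
          intro v w hvw
          refine exists_congr fun y => ?_
          simp only [mem_iInter]
          refine forall₂_congr fun S _ => S.2.2.2 _ _ fun j hj => ?_
          rcases eq_or_lt_of_le (show j ≤ i from hj) with rfl | h
          · simp
          · simp [h.ne, hvw h])
        simp only [mem_iInter] at hy
        exact ⟨y, hy⟩)
    exact ⟨y (), fun S h1 h2 h3 => hy ⟨S, h1, h2, h3⟩⟩
  rcases this with hne | he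
  swap
  · obtain ⟨v, -⟩ := U.nonempty_of_mem univ_mem
    have : IsEmpty I := ⟨fun i => he.elim (v i)⟩
    exact ⟨v, fun S _ hS => by
      obtain ⟨w, hw⟩ := U.nonempty_of_mem hS
      rwa [Subsingleton.elim v w]⟩
  let G : ∀ i : I, (∀ j, j < i → C) → C := fun i r =>
    Classical.epsilon fun y => Good (Iic i) (fun j => if h : j < i then r j h else y)
  let c : I → C := wellFounded_lt.fix G
  have hc : ∀ i, c i = G i fun j _ => c j := fun i => wellFounded_lt.fix_eq G i
  have hgood : ∀ i, Good (Iic i) c := by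
    intro i
    induction i using WellFoundedLT.induction with
    | ind i ih =>
      obtain ⟨y, hy⟩ := step i c (good_union _ c (isLowerSet_Iio i) ih)
      have hex : ∃ y, Good (Iic i) (fun j => if _ : j < i then c j else y) := ⟨y, by
        refine good_congr _ _ _ (fun j hj => ?_) hy
        rcases eq_or_lt_of_le (show j ≤ i from hj) with rfl | h
        · simp
        · simp [h.ne, h]⟩
      have := Classical.epsilon_spec hex
      refine good_congr _ _ _ (fun j hj => ?_) this
      rcases eq_or_lt_of_le (show j ≤ i from hj) with rfl | h
      · simp only [lt_irrefl, dite_false]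
        exact (hc j).symm
      · simp [h]
  exact ⟨c, fun S h1 h2 => good_union univ c isLowerSet_univ (fun j _ => hgood j) S h1 h2
    fun v w hvw => by rw [show v = w from funext fun i => hvw (mem_univ i)]⟩

theorem IsSaturated.nonempty_iInter_of_lt {κ : Cardinal.{max u v}} (hκ : ℵ₀ ≤ κ)
    (hC : IsSaturated L κ C) (hA : #A < κ) {I : Type (max u v)} (hI : #I < κ) {J : Type*}
    (f : J → Set (I → C)) (hf : ∀ j, A.Definable L (f j))
    (hfip : ∀ s : Finset J, ∃ c, ∀ j ∈ s, c ∈ f j) : ∃ c, ∀ j, c ∈ f j := by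
  classical
  have : (⨅ j, 𝓟 (f j)).NeBot := by
    rw [(hasBasis_iInf_principal_finite f).neBot_iff]
    intro t ht
    obtain ⟨c, hc⟩ := hfip ht.toFinset
    exact ⟨c, mem_iInter₂.2 fun j hj => hc j (ht.mem_toFinset.2 hj)⟩
  obtain ⟨c, hc⟩ := hC.exists_mem_of_ultrafilter hκ hA hI (Ultrafilter.of (⨅ j, 𝓟 (f j)))
  exact ⟨c, fun j => hc _ (hf j) (Ultrafilter.of_le _ (mem_iInf_of_mem j (mem_principal_self _)))⟩

end Definable

/-! ### Definable relations and functions on a definable group -/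

section DefinableOnGroup

variable (L : FirstOrder.Language.{u, v}) {C : Type*} [L.Structure C] {k : ℕ}
  {G : Set (Fin k → C)} {ι ι' : Type*}

/-- The coordinates of a tuple of elements of `G ⊆ Cᵏ`. -/
def flat (x : ι → G) : ι × Fin k → C := fun p => (x p.1 : Fin k → C) p.2

/-- A relation on `G ⊆ Cᵏ` is definable over `A`. -/
def DefSet (A : Set C) (S : Set (ι → G)) : Prop := A.Definable L (flat '' S)

/-- A function on `G ⊆ Cᵏ` is definable over `A`. -/
def DefFun (A : Set C) (f : (ι → G) → G) : Prop :=
  DefSet L A {z : ι ⊕ Unit → G | z (Sum.inr ()) = f (z ∘ Sum.inl)}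

/-- A subset of `G ⊆ Cᵏ` is definable over `A`. -/
def DefSub (A : Set C) (P : Set G) : Prop := DefSet L A {x : Unit → G | x () ∈ P}

variable {L} {A B : Set C}

theorem flat_injective : Function.Injective (flat : (ι → G) → ι × Fin k → C) := fun _ _ h =>
  funext fun i => Subtype.ext (funext fun j => congrFun h (i, j))

theorem mem_range_flat {w : ι × Fin k → C} :
    w ∈ flat '' (univ : Set (ι → G)) ↔ ∀ i, (fun j => w (i, j)) ∈ G :=
  ⟨fun ⟨x, _, hx⟩ i => hx ▸ (x i).2, fun h => ⟨fun i => ⟨_, h i⟩, trivial, rfl⟩⟩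

theorem flat_mem_image {S : Set (ι → G)} {x : ι → G} : flat x ∈ flat '' S ↔ x ∈ S :=
  flat_injective.mem_set_image

theorem DefSet.mono {S : Set (ι → G)} (hS : DefSet L A S) (h : A ⊆ B) : DefSet L B S :=
  Set.Definable.mono hS h

theorem DefSet.univ [Finite ι] (hG : A.Definable L G) : DefSet L A (univ : Set (ι → G)) := by
  have : flat '' (Set.univ : Set (ι → G)) =
      ⋂ i, (fun w : ι × Fin k → C => w ∘ fun j => (i, j)) ⁻¹' G := by
    ext w
    rw [mem_range_flat, mem_iInter]
    rfl
  rw [DefSet, this]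
  exact definable_iInter_of_finite fun i => hG.preimage_comp _

theorem DefSet.inter {S T : Set (ι → G)} (hS : DefSet L A S) (hT : DefSet L A T) :
    DefSet L A (S ∩ T) := by
  rw [DefSet, image_inter flat_injective]
  exact Set.Definable.inter hS hT

theorem DefSet.compl [Finite ι] (hG : A.Definable L G) {S : Set (ι → G)} (hS : DefSet L A S) :
    DefSet L A Sᶜ := by
  rw [DefSet, compl_eq_univ_sdiff, image_sdiff flat_injective]
  exact (DefSet.univ hG).sdiff hS

theorem DefSet.iInter [Finite ι] (hG : A.Definable L G) {J : Type*} [Finite J]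
    {S : J → Set (ι → G)} (hS : ∀ j, DefSet L A (S j)) : DefSet L A {x | ∀ j, x ∈ S j} := by
  have : flat '' {x | ∀ j, x ∈ S j} = flat '' (Set.univ : Set (ι → G)) ∩ ⋂ j, flat '' S j := by
    ext w
    constructor
    · rintro ⟨x, hx, rfl⟩
      exact ⟨⟨x, trivial, rfl⟩, mem_iInter.2 fun j => ⟨x, hx j, rfl⟩⟩
    · rintro ⟨⟨x, -, rfl⟩, hx⟩
      exact ⟨x, fun j => flat_mem_image.1 (mem_iInter.1 hx j), rfl⟩
  rw [DefSet, this]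
  exact Set.Definable.inter (DefSet.univ hG) (definable_iInter_of_finite hS)

theorem DefSet.preimage_comp [Finite ι'] (hG : A.Definable L G) {S : Set (ι → G)}
    (hS : DefSet L A S) (f : ι → ι') : DefSet L A {x : ι' → G | x ∘ f ∈ S} := by
  have : flat '' {x : ι' → G | x ∘ f ∈ S} = flat '' (Set.univ : Set (ι' → G)) ∩
      (fun w : ι' × Fin k → C => w ∘ Prod.map f id) ⁻¹' (flat '' S) := by
    ext w
    constructor
    · rintro ⟨x, hx, rfl⟩
      exact ⟨⟨x, trivial, rfl⟩, ⟨x ∘ f, hx, rfl⟩⟩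
    · rintro ⟨⟨x, -, rfl⟩, hx⟩
      exact ⟨x, (flat_mem_image (x := x ∘ f)).1 hx, rfl⟩
  rw [DefSet, this]
  exact Set.Definable.inter (DefSet.univ hG) (Set.Definable.preimage_comp _ hS)

theorem DefSet.exists [Finite ι'] {S : Set (ι ⊕ ι' → G)}
    (hS : DefSet L A S) : DefSet L A {x : ι → G | ∃ y : ι' → G, Sum.elim x y ∈ S} := by
  have : flat '' {x : ι → G | ∃ y : ι' → G, Sum.elim x y ∈ S} =
      {v | ∃ u : ι' × Fin k → C, Sum.elim v u ∈
        (fun w : (ι × Fin k) ⊕ (ι' × Fin k) → C => w ∘ Equiv.sumProdDistrib ι ι' (Fin k)) ⁻¹'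
          (flat '' S)} := by
    ext w
    constructor
    · rintro ⟨x, ⟨y, hy⟩, rfl⟩
      refine ⟨flat y, _, hy, ?_⟩
      funext ⟨i, j⟩
      rcases i with i | i <;> rfl
    · rintro ⟨u, z, hz, hu⟩
      refine ⟨z ∘ Sum.inl, ⟨z ∘ Sum.inr, by simpa using hz⟩, ?_⟩
      funext ⟨i, j⟩
      exact congrFun hu (Sum.inl i, j)
  rw [DefSet, this]
  exact (Set.Definable.preimage_comp _ hS).exists_of_finite

theorem DefSet.fiber {S : Set (ι ⊕ ι' → G)} (hS : DefSet L A S) (c : ι → G) :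
    DefSet L (A ∪ range (flat c)) ({y : ι' → G | Sum.elim c y ∈ S}) := by
  have : flat '' {y : ι' → G | Sum.elim c y ∈ S} =
      {u : ι' × Fin k → C | Sum.elim (flat c) u ∈
        (fun w : (ι × Fin k) ⊕ (ι' × Fin k) → C => w ∘ Equiv.sumProdDistrib ι ι' (Fin k)) ⁻¹'
          (flat '' S)} := by
    ext w
    constructor
    · rintro ⟨y, hy, rfl⟩
      refine ⟨_, hy, ?_⟩
      funext ⟨i, j⟩
      rcases i with i | i <;> rfl
    · rintro ⟨z, hz, hu⟩
      have h1 : z ∘ Sum.inl = c := flat_injective (funext fun ⟨i, j⟩ => congrFun hu (Sum.inl i, j))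
      refine ⟨z ∘ Sum.inr, ?_, ?_⟩
      · rw [mem_ofPred_eq, ← h1]
        simpa using hz
      · funext ⟨i, j⟩
        exact congrFun hu (Sum.inr i, j)
  rw [DefSet, this]
  exact (Set.Definable.preimage_comp _ hS).fiber _

theorem DefSet.eq [Finite ι] (hG : A.Definable L G) (i j : ι) :
    DefSet L A {x : ι → G | x i = x j} := by
  have : flat '' {x : ι → G | x i = x j} = flat '' (Set.univ : Set (ι → G)) ∩
      ⋂ l : Fin k, {w : ι × Fin k → C | w (i, l) = w (j, l)} := by
    ext w
    constructor
    · rintro ⟨x, hx, rfl⟩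
      refine ⟨⟨x, trivial, rfl⟩, mem_iInter.2 fun l => ?_⟩
      exact congrArg (fun g : G => (g : Fin k → C) l) hx
    · rintro ⟨⟨x, -, rfl⟩, hx⟩
      exact ⟨x, Subtype.ext (funext fun l => mem_iInter.1 hx l), rfl⟩
  rw [DefSet, this]
  refine Set.Definable.inter (DefSet.univ hG) (definable_iInter_of_finite fun l => ?_)
  exact ⟨(FirstOrder.Language.Term.var (i, l)).equal (FirstOrder.Language.Term.var (j, l)), by
    ext; simp⟩

theorem DefFun.proj [Finite ι] (hG : A.Definable L G) (i : ι) :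
    DefFun L A fun x : ι → G => x i :=
  DefSet.eq hG _ _

theorem DefSet.preimage [Finite ι] [Finite ι'] (hG : A.Definable L G) {S : Set (ι' → G)}
    (hS : DefSet L A S) {f : ι' → (ι → G) → G} (hf : ∀ i, DefFun L A (f i)) :
    DefSet L A {x : ι → G | (fun i => f i x) ∈ S} := by
  have h1 : ∀ i : ι', DefSet L A {z : ι ⊕ ι' → G | z (Sum.inr i) = f i (z ∘ Sum.inl)} := fun i =>
    DefSet.preimage_comp hG (hf i) (Sum.elim Sum.inl fun _ => Sum.inr i)
  have h2 := ((DefSet.iInter hG h1).inter (hS.preimage_comp hG Sum.inr)).exists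
  convert! h2 using 1
  ext x
  constructor
  · intro hx
    exact ⟨fun i => f i x, fun i => rfl, hx⟩
  · rintro ⟨y, hy, hyS⟩
    have : y = fun i => f i x := funext fun i => hy i
    rw [mem_ofPred_eq, ← this]
    exact hyS

theorem DefFun.comp_left [Finite ι] [Finite ι'] (hG : A.Definable L G) {f : (ι → G) → G}
    (hf : DefFun L A f) (r : ι → ι') : DefFun L A fun x : ι' → G => f (x ∘ r) :=
  DefSet.preimage_comp hG hf (Sum.map r id)

theorem DefFun.comp [Finite ι] [Finite ι'] (hG : A.Definable L G) {h : (ι' → G) → G}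
    (hh : DefFun L A h) {f : ι' → (ι → G) → G} (hf : ∀ i, DefFun L A (f i)) :
    DefFun L A fun x => h fun i => f i x := by
  have := DefSet.preimage (ι := ι ⊕ Unit) hG hh (f := Sum.elim (fun i z => f i (z ∘ Sum.inl))
    fun _ z => z (Sum.inr ())) (by
      rintro (i | i)
      · exact (hf i).comp_left hG Sum.inl
      · exact DefFun.proj hG _)
  exact this

theorem DefSet.setOf_eq [Finite ι] (hG : A.Definable L G) {f g : (ι → G) → G}
    (hf : DefFun L A f) (hg : DefFun L A g) : DefSet L A {x | f x = g x} := by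
  have := DefSet.preimage hG (DefSet.eq hG (0 : Fin 2) 1) (f := ![f, g]) (by
    intro i; fin_cases i <;> assumption)
  exact this

theorem DefFun.const [Finite ι] (hG : A.Definable L G) (g : G) (hg : ∀ j, (g : Fin k → C) j ∈ A) :
    DefFun L A fun _ : ι → G => g := by
  have h := DefSet.fiber (DefSet.eq hG (Sum.inl () : Unit ⊕ Unit) (Sum.inr ())) fun _ => g
  have h' : DefSet L A {y : Unit → G | g = y ()} := DefSet.mono h (by
    rintro a (ha | ⟨⟨-, j⟩, rfl⟩)
    exacts [ha, hg j])
  have := DefSet.preimage_comp hG h' (fun _ => (Sum.inr () : ι ⊕ Unit))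
  simpa only [DefFun, eq_comm] using! this

theorem DefSub.preimage [Finite ι] (hG : A.Definable L G) {P : Set G} (hP : DefSub L A P)
    {f : (ι → G) → G} (hf : DefFun L A f) : DefSet L A {x | f x ∈ P} :=
  DefSet.preimage hG hP (f := fun _ : Unit => f) fun _ => hf

theorem defSub_iff {P : Set G} : DefSub L A P ↔ A.Definable L ((↑) '' P : Set (Fin k → C)) := by
  constructor
  · intro h
    convert! Set.Definable.preimage_comp (fun p : Unit × Fin k => p.2) h using 2
    ext w
    constructor
    · rintro ⟨g, hg, rfl⟩
      exact ⟨fun _ => g, hg, rfl⟩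
    · rintro ⟨x, hx, hw⟩
      exact ⟨x (), hx, funext fun j => congrFun hw ((), j)⟩
  · intro h
    rw [DefSub, DefSet]
    convert! Set.Definable.preimage_comp (fun j : Fin k => ((), j)) h using 2
    ext w
    constructor
    · rintro ⟨x, hx, rfl⟩
      exact ⟨x (), hx, rfl⟩
    · rintro ⟨g, hg, hw⟩
      exact ⟨fun _ => g, hg, funext fun ⟨_, j⟩ => congrFun hw j⟩

theorem DefSub.mono {P : Set G} (hP : DefSub L A P) (h : A ⊆ B) : DefSub L B P :=
  DefSet.mono hP h

theorem DefSub.univ (hG : A.Definable L G) : DefSub L A (univ : Set G) := DefSet.univ hG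

theorem DefSub.inter {P Q : Set G} (hP : DefSub L A P) (hQ : DefSub L A Q) :
    DefSub L A (P ∩ Q) := DefSet.inter hP hQ

theorem DefSub.compl (hG : A.Definable L G) {P : Set G} (hP : DefSub L A P) :
    DefSub L A Pᶜ := DefSet.compl hG hP

theorem DefSub.biInter (hG : A.Definable L G) {J : Type*} (s : Finset J)
    {P : J → Set G} (hP : ∀ j, DefSub L A (P j)) : DefSub L A {g | ∀ j ∈ s, g ∈ P j} := by
  have := DefSet.iInter hG (J := s) fun j => hP j
  simpa [DefSub] using! this

end DefinableOnGroup

/-! ### The group operations are definable -/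

section GroupOperations

variable {L : FirstOrder.Language.{u, v}} {C : Type (max u v)} [L.Structure C] {k : ℕ}
  {G : Set (Fin k → C)} [Group G] {A B : Set C} {ι : Type*}

theorem IsDefinableGroup.mono (hG : IsDefinableGroup L A G) (h : A ⊆ B) :
    IsDefinableGroup L B G :=
  ⟨hG.1.mono h, hG.2.mono h⟩

theorem DefFun.mul [Finite ι] (hG : IsDefinableGroup L A G) {f g : (ι → G) → G}
    (hf : DefFun L A f) (hg : DefFun L A g) : DefFun L A fun x => f x * g x := by
  have h0 : DefSet L A {x : Fin 3 → G | x 0 * x 1 = x 2} := by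
    rw [DefSet]
    convert! hG.2 using 2
    ext w
    constructor
    · rintro ⟨x, hx, rfl⟩
      exact ⟨x 0, x 1, x 2, hx, fun j => ⟨rfl, rfl, rfl⟩⟩
    · rintro ⟨x, y, z, h, hw⟩
      refine ⟨![x, y, z], h, funext fun ⟨i, j⟩ => ?_⟩
      fin_cases i
      exacts [(hw j).1.symm, (hw j).2.1.symm, (hw j).2.2.symm]
  have h1 : DefFun L A fun x : Fin 2 → G => x 0 * x 1 := by
    rw [DefFun]
    simpa only [eq_comm] using!
      h0.preimage_comp hG.1 (![Sum.inl 0, Sum.inl 1, Sum.inr ()] : Fin 3 → Fin 2 ⊕ Unit)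
  exact DefFun.comp hG.1 h1 (f := ![f, g]) (by intro i; fin_cases i <;> assumption)

theorem DefFun.inv [Finite ι] (hG : IsDefinableGroup L A G) {f : (ι → G) → G}
    (hf : DefFun L A f) : DefFun L A fun x => (f x)⁻¹ := by
  have h0 : DefFun L A fun x : Unit → G => (x ())⁻¹ := by
    have h1 := DefFun.proj (A := A) (L := L) hG.1 (Sum.inl () : Unit ⊕ Unit)
    have h2 := DefFun.proj (A := A) (L := L) hG.1 (Sum.inr () : Unit ⊕ Unit)
    rw [DefFun]
    convert! DefSet.setOf_eq hG.1 ((h1.mul hG h2).mul hG h1) h1 using 2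
    ext x
    change x (Sum.inr ()) = (x (Sum.inl ()))⁻¹ ↔
      x (Sum.inl ()) * x (Sum.inr ()) * x (Sum.inl ()) = x (Sum.inl ())
    rw [_root_.mul_eq_right, mul_eq_one_iff_eq_inv']
  exact DefFun.comp hG.1 h0 (f := fun _ => f) fun _ => hf

theorem DefFun.one [Finite ι] (hG : IsDefinableGroup L A G) :
    DefFun L A fun _ : ι → G => (1 : G) := by
  have h := DefFun.proj (A := A) (L := L) hG.1 (Sum.inr () : ι ⊕ Unit)
  rw [DefFun]
  convert! DefSet.setOf_eq hG.1 (h.mul hG h) h using 2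
  ext x
  simp

end GroupOperations

/-! ### Compactness for subsets of a definable group -/

section Monster

variable {L : FirstOrder.Language.{u, v}} {C : Type (max u v)} [L.Structure C] {k : ℕ}
  {G : Set (Fin k → C)} {A B : Set C} {κ : Cardinal.{max u v}}

theorem IsMonster.aleph0_le (hC : IsMonster L κ C) : ℵ₀ ≤ κ :=
  (self_le_add_left _ _).trans hC.thCard_lt.le

theorem IsMonster.nonempty_iInter (hC : IsMonster L κ C) (hA : #A < κ) {ι : Type*} [Finite ι]
    {J : Type*} (f : J → Set (ι → G)) (hf : ∀ j, DefSet L A (f j))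
    (hfip : ∀ s : Finset J, ∃ c, ∀ j ∈ s, c ∈ f j) : ∃ c, ∀ j, c ∈ f j := by
  rcases isEmpty_or_nonempty J with hJ | ⟨⟨j₀⟩⟩
  · obtain ⟨c, -⟩ := hfip ∅
    exact ⟨c, fun j => hJ.elim j⟩
  · obtain ⟨w, hw⟩ := hC.saturated.nonempty_iInter hA (fun j => flat '' f j) hf (by
      intro s
      obtain ⟨c, hc⟩ := hfip s
      exact ⟨flat c, fun j hj => ⟨c, hc j hj, rfl⟩⟩)
    obtain ⟨c, -, rfl⟩ := hw j₀
    exact ⟨c, fun j => flat_mem_image.1 (hw j)⟩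

theorem card_union_range_flat_lt (hC : IsMonster L κ C) (hA : #A < κ) {ι : Type*} [Finite ι]
    (c : ι → G) : #(A ∪ range (flat c) : Set C) < κ := by
  refine (mk_union_le _ _).trans_lt (add_lt_of_lt hC.aleph0_le hA ?_)
  exact ((lt_aleph0_iff_set_finite).2 (finite_range _)).trans_le hC.aleph0_le

/-- If a definable relation contains a product of filtered intersections of definable sets, then it
contains a product of members. -/
theorem IsMonster.exists_forall_mem (hC : IsMonster L κ C) (hG : B.Definable L G) (hB : #B < κ)
    {ι : Type*} [Finite ι] (F : ι → Set (Set G)) (hF : ∀ i, ∀ P ∈ F i, DefSub L B P)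
    (huniv : ∀ i, Set.univ ∈ F i) (hinter : ∀ i, ∀ P ∈ F i, ∀ Q ∈ F i, P ∩ Q ∈ F i)
    {R : Set (ι → G)} (hR : DefSet L B R) (h : ∀ x, (∀ i, ∀ P ∈ F i, x i ∈ P) → x ∈ R) :
    ∃ P : ι → Set G, (∀ i, P i ∈ F i) ∧ ∀ x, (∀ i, x i ∈ P i) → x ∈ R := by
  classical
  -- Otherwise the complement of R together with all members of the families is finitely
  -- satisfiable, and a realization contradicts `h`.
  by_contra! hcon
  let f : Option (Σ i, F i) → Set (ι → G) := fun o => o.elim Rᶜ fun p => {x | x p.1 ∈ p.2.1}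
  obtain ⟨x, hx⟩ := hC.nonempty_iInter hB f (by
    rintro (_ | p)
    · exact hR.compl hG
    · exact (hF _ _ p.2.2).preimage hG (DefFun.proj hG p.1)) (by
    intro s
    have hfin : ∀ i (t : Finset (F i)), {g | ∀ P ∈ t, g ∈ P.1} ∈ F i := by
      intro i t
      induction t using Finset.induction with
      | empty => simpa using huniv i
      | insert P t _ ih =>
        convert! hinter i P.1 P.2 _ ih using 1
        ext g
        simp
    have hinj : ∀ i, Function.Injective fun P : F i => (some ⟨i, P⟩ : Option (Σ i, F i)) :=
      fun i P Q h => eq_of_heq (Sigma.mk.inj (Option.some.inj h)).2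
    obtain ⟨x, hx, hxR⟩ := hcon
      (fun i => {g | ∀ P ∈ s.preimage _ (hinj i).injOn, g ∈ P.1}) fun i => hfin i _
    refine ⟨x, ?_⟩
    rintro (_ | ⟨i, P⟩) hj
    · exact hxR
    · exact hx i P (Finset.mem_preimage.2 hj))
  exact hx none (h x fun i P hP => hx (some ⟨i, P, hP⟩))

/-! ### Type-definable sets -/

variable (L) in
/-- A subset of `G` is type-definable over `A`: it is the intersection of its supersets definable
over `A`. -/
def IsTD {C : Type*} [L.Structure C] {G : Set (Fin k → C)} (A : Set C) (Y : Set G) : Prop :=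
  ∀ g, (∀ P, DefSub L A P → Y ⊆ P → g ∈ P) → g ∈ Y

theorem DefSub.isTD {P : Set G} (hP : DefSub L A P) : IsTD L A P :=
  fun _ hg => hg P hP subset_rfl

/-- Compactness for products of type-definable sets. -/
theorem IsMonster.exists_defSub (hC : IsMonster L κ C) (hG : A.Definable L G) (hAB : A ⊆ B)
    (hB : #B < κ) {ι : Type*} [Finite ι] (Y : ι → Set G) (hY : ∀ i, IsTD L A (Y i))
    {R : Set (ι → G)} (hR : DefSet L B R) (h : ∀ x, (∀ i, x i ∈ Y i) → x ∈ R) :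
    ∃ P : ι → Set G, (∀ i, DefSub L A (P i) ∧ Y i ⊆ P i) ∧ ∀ x, (∀ i, x i ∈ P i) → x ∈ R :=
  hC.exists_forall_mem (hG.mono hAB) hB (fun i => {P | DefSub L A P ∧ Y i ⊆ P})
    (fun _ _ hP => hP.1.mono hAB) (fun _ => ⟨DefSub.univ hG, subset_univ _⟩)
    (fun _ _ hP _ hQ => ⟨hP.1.inter hQ.1, subset_inter hP.2 hQ.2⟩) hR
    fun x hx => h x fun i => hY i _ fun P h1 h2 => hx i P ⟨h1, h2⟩

/-! ### Automorphisms acting on a definable group -/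

theorem map_mem_of_equiv (hG : A.Definable L G) (σ : C ≃[L] C) (hσ : ∀ a ∈ A, σ a = a) (g : G) :
    (fun j => σ ((g : Fin k → C) j)) ∈ G :=
  (hG.mem_iff_of_equiv σ hσ _).1 g.2

theorem symm_fixes {σ : C ≃[L] C} (hσ : ∀ a ∈ A, σ a = a) : ∀ a ∈ A, σ.symm a = a :=
  fun a ha => by
    conv_lhs => rw [← hσ a ha]
    exact σ.symm_apply_apply a

variable [Group G]

/-- The action on a definable group of an automorphism fixing the parameters. -/
noncomputable def autG (hG : IsDefinableGroup L A G) (σ : C ≃[L] C) (hσ : ∀ a ∈ A, σ a = a) :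
    G ≃* G where
  toFun g := ⟨_, map_mem_of_equiv hG.1 σ hσ g⟩
  invFun g := ⟨_, map_mem_of_equiv hG.1 σ.symm (symm_fixes hσ) g⟩
  left_inv g := Subtype.ext (funext fun j => σ.symm_apply_apply _)
  right_inv g := Subtype.ext (funext fun j => σ.apply_symm_apply _)
  map_mul' x y := by
    have h := (hG.2.mem_iff_of_equiv σ hσ
      (fun p : Fin 3 × Fin k => ((![x, y, x * y] p.1 : G) : Fin k → C) p.2)).1
      ⟨x, y, x * y, rfl, fun j => ⟨rfl, rfl, rfl⟩⟩
    obtain ⟨x', y', z', h1, h2⟩ := h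
    have hx : (⟨_, map_mem_of_equiv hG.1 σ hσ x⟩ : G) = x' :=
      Subtype.ext (funext fun j => (h2 j).1)
    have hy : (⟨_, map_mem_of_equiv hG.1 σ hσ y⟩ : G) = y' :=
      Subtype.ext (funext fun j => (h2 j).2.1)
    have hz : (⟨_, map_mem_of_equiv hG.1 σ hσ (x * y)⟩ : G) = z' :=
      Subtype.ext (funext fun j => (h2 j).2.2)
    rw [hx, hy, hz, h1]

theorem DefSet.mem_iff_autG {ι : Type*} {S : Set (ι → G)} (hS : DefSet L A S)
    (hG : IsDefinableGroup L A G) (σ : C ≃[L] C) (hσ : ∀ a ∈ A, σ a = a) (x : ι → G) :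
    x ∈ S ↔ (fun i => autG hG σ hσ (x i)) ∈ S := by
  rw [← flat_mem_image, hS.mem_iff_of_equiv σ hσ, ← flat_mem_image (S := S)]
  rfl

theorem DefSub.mem_iff_autG {P : Set G} (hP : DefSub L A P)
    (hG : IsDefinableGroup L A G) (σ : C ≃[L] C) (hσ : ∀ a ∈ A, σ a = a) (g : G) :
    g ∈ P ↔ autG hG σ hσ g ∈ P :=
  DefSet.mem_iff_autG hP hG σ hσ fun _ => g

theorem IsMonster.exists_autG (hC : IsMonster L κ C) (hA : #A < κ) (hG : IsDefinableGroup L A G)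
    {ι : Type (max u v)} (hι : #ι < κ) {x y : ι → G}
    (h : ∀ (n : ℕ) (e : Fin n → ι) (S : Set (Fin n → G)), DefSet L A S → x ∘ e ∈ S → y ∘ e ∈ S) :
    ∃ (σ : C ≃[L] C) (hσ : ∀ a ∈ A, σ a = a), ∀ i, autG hG σ hσ (x i) = y i := by
  classical
  have hcard : #(ι × Fin k) < κ := by
    rw [mk_prod]
    refine mul_lt_of_lt hC.aleph0_le (by simpa using hι) ?_
    simpa using natCast_lt_aleph0 (n := k).trans_le hC.aleph0_le
  obtain ⟨σ, hσ, h'⟩ := hC.homogeneous.exists_equiv hC.aleph0_le hA hcard (a := flat x)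
    (b := flat y) (by
      intro S hS hx
      obtain ⟨F, S', hS', hSS'⟩ := hS.exists_finset_preimage
      let F₁ := F.image Prod.fst
      let e : F₁ ≃ Fin F₁.card := F₁.equivFin
      let r : F → Fin F₁.card × Fin k := fun p => (e ⟨p.1.1, Finset.mem_image_of_mem _ p.2⟩, p.1.2)
      have hT : DefSet L A {z : Fin F₁.card → G | flat z ∘ r ∈ S'} := by
        have : flat '' {z : Fin F₁.card → G | flat z ∘ r ∈ S'} =
            flat '' (Set.univ : Set (Fin F₁.card → G)) ∩ (fun w => w ∘ r) ⁻¹' S' := by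
          ext w
          constructor
          · rintro ⟨z, hz, rfl⟩
            exact ⟨⟨z, trivial, rfl⟩, hz⟩
          · rintro ⟨⟨z, -, rfl⟩, hz⟩
            exact ⟨z, hz, rfl⟩
        rw [DefSet, this]
        exact Set.Definable.inter (DefSet.univ hG.1) (hS'.preimage_comp r)
      have hz : ∀ z : ι → G, flat z ∈ S ↔
          (z ∘ fun i => ((e.symm i).1 : ι)) ∈ {z : Fin F₁.card → G | flat z ∘ r ∈ S'} := by
        intro z
        rw [hSS']
        refine iff_of_eq (congrArg (· ∈ S') (funext fun p => ?_))
        simp [flat, r]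
      rw [hz] at hx ⊢
      exact h _ _ _ hT hx)
  exact ⟨σ, hσ, fun i => Subtype.ext (funext fun j => h' (i, j))⟩

theorem IsMonster.exists_autG_eq (hC : IsMonster L κ C) (hA : #A < κ)
    (hG : IsDefinableGroup L A G) {g h : G} (hgh : ∀ P, DefSub L A P → g ∈ P → h ∈ P) :
    ∃ (σ : C ≃[L] C) (hσ : ∀ a ∈ A, σ a = a), autG hG σ hσ g = h := by
  obtain ⟨σ, hσ, h'⟩ := hC.exists_autG hA hG (ι := PUnit) (x := fun _ => g) (y := fun _ => h)
    (by simpa using one_lt_aleph0.trans_le hC.aleph0_le) (by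
      intro n e S hS hx
      exact hgh {g | (fun _ => g) ∈ S} (hS.preimage_comp hG.1 fun _ => ()) hx)
  exact ⟨σ, hσ, h' ⟨⟩⟩

/-! ### Products of type-definable sets -/

/-- If g ∉ Y * Z, compactness gives definable P₀ ⊇ Y and P₁ ⊇ Z with g ∉ P₀ * P₁, and this product
is definable over A. -/
theorem IsTD.mul (hC : IsMonster L κ C) (hG : IsDefinableGroup L A G) (hA : #A < κ) {Y Z : Set G}
    (hY : IsTD L A Y) (hZ : IsTD L A Z) : IsTD L A (Y * Z) := by
  intro g hg
  by_contra hgYZ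
  have hsub : A ⊆ A ∪ range (flat fun _ : Unit => g) := subset_union_left
  have hG' := hG.mono hsub
  obtain ⟨P, hP, hPR⟩ := hC.exists_defSub hG.1 hsub
    (card_union_range_flat_lt hC hA _) (ι := Fin 2) ![Y, Z]
    (by intro i; fin_cases i <;> assumption) (R := {x | x 0 * x 1 = g}ᶜ)
    ((DefSet.setOf_eq hG'.1 ((DefFun.proj hG'.1 0).mul hG' (DefFun.proj hG'.1 1))
      (DefFun.const hG'.1 g fun j => Or.inr ⟨((), j), rfl⟩)).compl hG'.1)
    fun x hx hxg => hgYZ ⟨x 0, hx 0, x 1, hx 1, hxg⟩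
  have hD : DefSub L A (P 0 * P 1) := by
    have h1 : DefSet L A {z : Unit ⊕ Unit → G | z (Sum.inr ()) ∈ P 0} :=
      (hP 0).1.preimage hG.1 (DefFun.proj hG.1 _)
    have h2 : DefSet L A {z : Unit ⊕ Unit → G | (z (Sum.inr ()))⁻¹ * z (Sum.inl ()) ∈ P 1} :=
      (hP 1).1.preimage hG.1 (((DefFun.proj hG.1 _).inv hG).mul hG (DefFun.proj hG.1 _))
    rw [DefSub]
    convert! (h1.inter h2).exists using 2
    ext x
    constructor
    · rintro ⟨a, ha, b, hb, hab⟩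
      refine ⟨fun _ => a, ha, ?_⟩
      simpa [← hab] using hb
    · rintro ⟨y, h1, h2⟩
      exact ⟨_, h1, _, h2, by simp⟩
  obtain ⟨a, ha, b, hb, hab⟩ := hg _ hD (mul_subset_mul (hP 0).2 (hP 1).2)
  exact hPR ![a, b] (by intro i; fin_cases i <;> assumption) hab

theorem IsTD.inv (hG : IsDefinableGroup L A G) {Y : Set G} (hY : IsTD L A Y) : IsTD L A Y⁻¹ := by
  intro g hg
  refine hY _ fun P hP hYP => ?_
  exact hg P⁻¹ (hP.preimage hG.1 ((DefFun.proj hG.1 ()).inv hG)) (inv_subset_inv.2 hYP)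

theorem isTD_one (hG : IsDefinableGroup L A G) : IsTD L A (1 : Set G) :=
  DefSub.isTD (DefSet.setOf_eq hG.1 (DefFun.proj hG.1 ()) (DefFun.one hG))

theorem IsTD.pow (hC : IsMonster L κ C) (hG : IsDefinableGroup L A G) (hA : #A < κ) {Y : Set G}
    (hY : IsTD L A Y) (n : ℕ) : IsTD L A (Y ^ n) := by
  induction n with
  | zero => exact isTD_one hG
  | succ n ih => rw [pow_succ]; exact ih.mul hC hG hA hY

end Monster

/-! ### Thick sets -/

section Thick

variable {G : Type*} [Group G]

/-- `P` is thick: for every ultrafilter on the group, the quotient `y / x` of two elements chosen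
successively along the ultrafilter lies in `P`. -/
def Thick (P : Set G) : Prop := ∀ U : Ultrafilter G, ∀ᶠ x in U, ∀ᶠ y in U, y * x⁻¹ ∈ P

theorem thick_univ : Thick (Set.univ : Set G) := fun _ => by simp

theorem Thick.inter {P Q : Set G} (hP : Thick P) (hQ : Thick Q) : Thick (P ∩ Q) := fun U => by
  filter_upwards [hP U, hQ U] with x h1 h2
  filter_upwards [h1, h2] with y h3 h4 using ⟨h3, h4⟩

/-- Otherwise the sets {g | g f⁻¹ ∉ P} have the finite intersection property, and an ultrafilter
containing them all violates thickness. -/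
theorem Thick.exists_cover {P : Set G} (hP : Thick P) :
    ∃ F : Finset G, ∀ g, ∃ f ∈ F, g * f⁻¹ ∈ P := by
  by_contra! hcon
  have : (⨅ f : G, 𝓟 {g | g * f⁻¹ ∉ P}).NeBot := by
    rw [(hasBasis_iInf_principal_finite _).neBot_iff]
    intro t ht
    obtain ⟨g, hg⟩ := hcon ht.toFinset
    exact ⟨g, mem_iInter₂.2 fun f hf => hg f (ht.mem_toFinset.2 hf)⟩
  obtain ⟨x, hx⟩ := (hP (Ultrafilter.of (⨅ f : G, 𝓟 {g | g * f⁻¹ ∉ P}))).exists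
  have hx' : ∀ᶠ y in (Ultrafilter.of (⨅ f : G, 𝓟 {g | g * f⁻¹ ∉ P}) : Filter G), y * x⁻¹ ∉ P :=
    Ultrafilter.of_le _ (mem_iInf_of_mem x (mem_principal_self _))
  obtain ⟨y, h1, h2⟩ := (hx.and hx').exists
  exact h2 h1

/-- Elements are picked one at a time along an ultrafilter witnessing failure. Each x picked keeps y
x⁻¹ ∉ P for almost all y, so the next pick can avoid P against all earlier ones. -/
theorem exists_seq_of_not_thick {P : Set G} (hP : ¬ Thick P) {I : Type*} [LinearOrder I]
    (s : Finset I) : ∃ x : I → G, ∀ i ∈ s, ∀ j ∈ s, i < j → x j * (x i)⁻¹ ∉ P := by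
  classical
  obtain ⟨U, hU⟩ := not_forall.1 hP
  rw [← Ultrafilter.eventually_not] at hU
  simp only [← Ultrafilter.eventually_not] at hU
  suffices h : ∃ x : I → G, (∀ i ∈ s, ∀ᶠ y in U, y * (x i)⁻¹ ∉ P) ∧
      ∀ i ∈ s, ∀ j ∈ s, i < j → x j * (x i)⁻¹ ∉ P from h.imp fun _ h => h.2
  induction s using Finset.induction_on_max with
  | empty => exact ⟨fun _ => 1, by simp, by simp⟩
  | insert a s ha ih =>
    obtain ⟨x, h1, h2⟩ := ih
    obtain ⟨y, hy1, hy2⟩ := (hU.and ((eventually_all_finset s).2 h1)).exists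
    have hs : ∀ i ∈ s, Function.update x a y i = x i := fun i hi =>
      Function.update_of_ne (ha i hi).ne _ _
    refine ⟨Function.update x a y, fun i hi => ?_, fun i hi j hj hij => ?_⟩
    · rcases Finset.mem_insert.1 hi with rfl | hi
      · simpa using hy1
      · simpa [hs i hi] using h1 i hi
    · rcases Finset.mem_insert.1 hi with rfl | hi' <;> rcases Finset.mem_insert.1 hj with rfl | hj'
      · exact absurd hij (lt_irrefl _)
      · exact absurd hij (ha j hj').not_gt
      · simpa [hs i hi'] using hy2 i hi'
      · simpa [hs i hi', hs j hj'] using h2 i hi' j hj' hij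

end Thick

/-! ### The core and subgroups of small index -/

section Core

variable (L : FirstOrder.Language.{u, v}) {k : ℕ}

/-- The intersection of all thick sets definable over `A`. -/
def core {C : Type*} [L.Structure C] (A : Set C) (G : Set (Fin k → C)) [Group G] : Set G :=
  {h | ∀ P, DefSub L A P → Thick P → h ∈ P}

variable {L} {C : Type (max u v)} [L.Structure C]
  {G : Set (Fin k → C)} {A B : Set C} {κ : Cardinal.{max u v}} [Group G]

theorem core_anti (h : A ⊆ B) : core L B G ⊆ core L A G := fun _ hg P hP => hg P (hP.mono h)

theorem isTD_core : IsTD L A (core L A G) := fun _ hg P h1 h2 => hg P h1 fun _ hx => hx P h1 h2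

/-- Thick definable sets are closed under finite intersection, so compactness moves the intersection
inside the product. -/
theorem mem_core_mul_inv (hC : IsMonster L κ C) (hG : IsDefinableGroup L A G) (hA : #A < κ) {g : G}
    (hg : ∀ P, DefSub L A P → Thick P → g ∈ P * P⁻¹) : g ∈ core L A G * (core L A G)⁻¹ := by
  by_contra hcon
  have hsub : A ⊆ A ∪ range (flat fun _ : Unit => g) := subset_union_left
  have hG' := hG.mono hsub
  obtain ⟨P, hP, hPR⟩ := hC.exists_forall_mem hG'.1 (card_union_range_flat_lt hC hA _)
    (ι := Fin 2) (fun _ => {P : Set G | DefSub L A P ∧ Thick P}) (fun _ _ hP => hP.1.mono hsub)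
    (fun _ => ⟨DefSub.univ hG.1, thick_univ⟩)
    (fun _ _ hP _ hQ => ⟨hP.1.inter hQ.1, hP.2.inter hQ.2⟩)
    (R := {x | x 0 * (x 1)⁻¹ = g}ᶜ)
    ((DefSet.setOf_eq hG'.1 ((DefFun.proj hG'.1 0).mul hG' ((DefFun.proj hG'.1 1).inv hG'))
      (DefFun.const hG'.1 g fun j => Or.inr ⟨((), j), rfl⟩)).compl hG'.1)
    fun x hx hxg => hcon ⟨x 0, fun P h1 h2 => hx 0 P ⟨h1, h2⟩, (x 1)⁻¹,
      inv_mem_inv.2 fun P h1 h2 => hx 1 P ⟨h1, h2⟩, hxg⟩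
  obtain ⟨a, ha, b, hb, hab⟩ := hg _ ((hP 0).1.inter (hP 1).1) ((hP 0).2.inter (hP 1).2)
  refine hPR ![a, b⁻¹] (fun i => ?_) (by simpa using hab)
  fin_cases i
  · exact ha.1
  · exact (mem_inv.1 hb).2

/-- A subgroup of small index contained in an invariant set forces the set to contain the core. -/
theorem core_subset (hC : IsMonster L κ C) (hG : IsDefinableGroup L A G) (hA : #A < κ)
    (K : Subgroup G) (hK : #(G ⧸ K) < κ) {E : Set G} (hKE : (K : Set G) ⊆ E)
    (hE : ∀ (σ : C ≃[L] C) (hσ : ∀ a ∈ A, σ a = a), ∀ x ∈ E, autG hG σ hσ x ∈ E) :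
    core L A G ⊆ E := by
  classical
  intro h hh
  -- Longer than the index of K, for the pigeonhole, yet small because κ is a limit cardinal.
  let I := (Order.succ (max ℵ₀ #(G ⧸ K))).ord.ToType
  have hI : #I = Order.succ (max ℵ₀ #(G ⧸ K)) := by simp [I]
  have hIκ : #I < κ := by
    rw [hI]
    exact hC.isStrongLimit.isSuccLimit.succ_lt
      (max_lt ((self_le_add_left _ _).trans_lt hC.thCard_lt) hK)
  have hcard : #(I × Fin k) < κ := by
    rw [mk_prod]
    refine mul_lt_of_lt hC.aleph0_le (by simpa using hIκ) ?_
    simpa using (natCast_lt_aleph0 (n := k)).trans_le hC.aleph0_le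
  let J := {p : I × I // p.1 < p.2} × {P : Set G // DefSub L A P ∧ h ∈ P}
  let r : I × I → Fin 2 → I := fun p => ![p.1, p.2]
  have hdef : ∀ P : Set G, DefSub L A P → DefSet L A {z : Fin 2 → G | z 1 * (z 0)⁻¹ ∈ P} :=
    fun P hP => hP.preimage hG.1 ((DefFun.proj hG.1 1).mul hG ((DefFun.proj hG.1 0).inv hG))
  obtain ⟨w, hw⟩ := hC.saturated.nonempty_iInter_of_lt hC.aleph0_le hA hcard
    (fun j : J => (fun w : I × Fin k → C => w ∘ Prod.map (r j.1.1) id) ⁻¹'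
      (flat '' {z : Fin 2 → G | z 1 * (z 0)⁻¹ ∈ j.2.1}))
    (fun j => Set.Definable.preimage_comp _ (hdef _ j.2.2.1)) (by
      intro s
      let P₀ : Set G := {g | ∀ j ∈ s, g ∈ j.2.1}
      have hP₀ : DefSub L A P₀ := DefSub.biInter hG.1 s fun j => j.2.2.1
      -- A thick P₀ᶜ would contain h, as h is in the core, whereas h ∈ P₀.
      have hnt : ¬ Thick P₀ᶜ := fun ht => hh _ (hP₀.compl hG.1) ht fun j _ => j.2.2.2
      obtain ⟨x, hx⟩ := exists_seq_of_not_thick hnt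
        (s.image (fun j => j.1.1.1) ∪ s.image (fun j => j.1.1.2))
      refine ⟨flat x, fun j hj => ⟨x ∘ r j.1.1, ?_, rfl⟩⟩
      have := hx j.1.1.1 (Finset.mem_union_left _ (Finset.mem_image_of_mem _ hj)) j.1.1.2
        (Finset.mem_union_right _ (Finset.mem_image_of_mem _ hj)) j.1.2
      exact not_not.1 this j hj)
  have hx : ∀ i, ∃ g : G, ∀ j, (g : Fin k → C) j = w (i, j) := by
    have h2 : ∀ p : {p : I × I // p.1 < p.2}, ∃ z : Fin 2 → G,
        flat z = w ∘ Prod.map (r p.1) id := fun p => by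
      obtain ⟨z, -, hz⟩ := hw (p, ⟨Set.univ, DefSub.univ hG.1, trivial⟩)
      exact ⟨z, hz⟩
    intro i
    have hnt : Nontrivial I := by
      rw [← one_lt_iff_nontrivial, hI]
      exact (one_lt_aleph0.trans_le (le_max_left _ _)).trans (Order.lt_succ _)
    obtain ⟨i', hi'⟩ := exists_ne i
    rcases hi'.lt_or_gt with hlt | hlt
    · obtain ⟨z, hz⟩ := h2 ⟨(i', i), hlt⟩
      exact ⟨z 1, fun j => congrFun hz (1, j)⟩
    · obtain ⟨z, hz⟩ := h2 ⟨(i, i'), hlt⟩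
      exact ⟨z 0, fun j => congrFun hz (0, j)⟩
  choose x hx using hx
  have hpair : ∀ i j, i < j → ∀ P, DefSub L A P → h ∈ P → x j * (x i)⁻¹ ∈ P := by
    intro i j hij P hP hhP
    obtain ⟨z, hz, hzw⟩ := hw (⟨(i, j), hij⟩, ⟨P, hP, hhP⟩)
    have h0 : z 0 = x i := Subtype.ext (funext fun l => (congrFun hzw (0, l)).trans (hx i l).symm)
    have h1 : z 1 = x j := Subtype.ext (funext fun l => (congrFun hzw (1, l)).trans (hx j l).symm)
    rw [← h0, ← h1]
    exact hz
  have hlt : #(G ⧸ K) < #I := by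
    rw [hI]
    exact (le_max_right _ _).trans_lt (Order.lt_succ _)
  -- The inverses are used because left cosets of x_i⁻¹ and x_j⁻¹ agree exactly when x_j x_i⁻¹ ∈ K.
  obtain ⟨i, j, hne, heq⟩ : ∃ i j, i ≠ j ∧ (((x i)⁻¹ : G) : G ⧸ K) = ((x j)⁻¹ : G) := by
    by_contra! hcon
    refine hlt.not_ge (mk_le_of_injective (f := fun i => (((x i)⁻¹ : G) : G ⧸ K)) ?_)
    intro i j hij
    by_contra hne
    exact hcon i j hne hij
  wlog hij : i < j generalizing i j
  · exact this j i hne.symm heq.symm (hne.lt_or_gt.resolve_left hij)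
  have hmem : x j * (x i)⁻¹ ∈ K := by
    simpa using QuotientGroup.eq.1 heq.symm
  obtain ⟨σ, hσ, hσh⟩ := hC.exists_autG_eq hA hG (hpair i j hij)
  have := hE σ.symm (symm_fixes hσ) _ (hKE hmem)
  rw [← hσh] at this
  convert! this using 1
  exact ((autG hG σ hσ).symm_apply_apply h).symm

end Core

/-! ### The component as the smallest invariant subgroup of small index -/

section Component

variable (L : FirstOrder.Language.{u, v}) {k : ℕ}

/-- The subgroup generated by the intersection of all thick sets definable over `A`. -/
def component {C : Type*} [L.Structure C] (A : Set C) (G : Set (Fin k → C)) [Group G] :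
    Subgroup G := Subgroup.closure (core L A G)

variable {L} {C : Type (max u v)} [L.Structure C]
  {G : Set (Fin k → C)} {A B : Set C} {κ : Cardinal.{max u v}}

theorem aleph0_le_thCard : ℵ₀ ≤ thCard L := self_le_add_left _ _

theorem mk_formula_le (L : FirstOrder.Language.{u, v}) (α : Type u') :
    #(L.Formula α) ≤ max ℵ₀ (Cardinal.lift.{max u v} #α + Cardinal.lift.{u'} L.card) :=
  (mk_le_of_injective (f := fun φ : L.Formula α => (⟨0, φ⟩ : Σ n, L.BoundedFormula α n))
    fun _ _ h => eq_of_heq (Sigma.mk.inj h).2).trans FirstOrder.Language.BoundedFormula.card_le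

theorem mk_defSet_le (ι : Type) [Countable ι] :
    #{S : Set (ι → G) // DefSet L A S} ≤ thCard L + #A := by
  have hinj : Function.Injective fun S : {S : Set (ι → G) // DefSet L A S} => S.2.choose := by
    intro S T h
    have := S.2.choose_spec.trans ((congrArg (fun φ : L[[A]].Formula (ι × Fin k) =>
      Set.ofPred φ.Realize) h).trans T.2.choose_spec.symm)
    exact Subtype.ext (flat_injective.image_injective this)
  refine ((mk_le_of_injective hinj).trans (mk_formula_le _ _)).trans
    (max_le (aleph0_le_thCard.trans (self_le_add_right _ _)) ?_)
  have h3 : #(ι × Fin k) ≤ ℵ₀ := mk_le_aleph0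
  rw [FirstOrder.Language.card_withConstants, thCard, add_comm L.card, add_assoc]
  refine add_le_add (lift_le_aleph0.2 h3) ?_
  simp

/-- A coset is coded by recording, for each thick definable P, which translate of a finite cover
contains the inverse of its representative. Equal codes put q⁻¹q' in every P * P⁻¹, hence in core *
core⁻¹. There are at most ℵ₀ ^ (|T| + |A|) codes. -/
theorem index_component_le (hC : IsMonster L κ C) [Group G] (hG : IsDefinableGroup L A G)
    (hA : #A < κ) : HasSmallIndex L A (component L A G) := by
  classical
  let D := {P : Set G // DefSub L A P ∧ Thick P}
  choose F hF using fun P : D => P.2.2.exists_cover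
  choose f hfF hf using hF
  have hinj : Function.Injective fun (q : G ⧸ component L A G) (P : D) =>
      (((F P).equivFin ⟨f P q.out⁻¹, hfF _ _⟩ : Fin _) : ℕ) := by
    intro q q' h
    rw [← q.out_eq', ← q'.out_eq', QuotientGroup.eq]
    have hmem : q.out⁻¹ * q'.out ∈ core L A G * (core L A G)⁻¹ := by
      refine mem_core_mul_inv hC hG hA fun P h1 h2 => ?_
      have h3 : f ⟨P, h1, h2⟩ q.out⁻¹ = f ⟨P, h1, h2⟩ q'.out⁻¹ := by
        have := congrFun h ⟨P, h1, h2⟩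
        simpa [Fin.val_inj] using this
      refine ⟨_, hf ⟨P, h1, h2⟩ q.out⁻¹, (q'.out⁻¹ * (f ⟨P, h1, h2⟩ q'.out⁻¹)⁻¹)⁻¹,
        inv_mem_inv.2 (hf ⟨P, h1, h2⟩ q'.out⁻¹), ?_⟩
      simp [h3, mul_assoc]
    obtain ⟨a, ha, b, hb, hab⟩ := hmem
    rw [← hab]
    exact mul_mem (Subgroup.subset_closure ha)
      (inv_mem_iff.1 (Subgroup.subset_closure hb))
  have hD : #D ≤ thCard L + #A :=
    (mk_le_of_injective (f := fun P : D => (⟨_, P.2.1⟩ : {S : Set (Unit → G) // DefSet L A S}))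
      fun P Q h => Subtype.ext (Set.ext fun g => by
        have := congrArg (fun S => (fun _ => g) ∈ S.1) h
        exact iff_of_eq this)).trans (mk_defSet_le Unit)
  have hinf : ℵ₀ ≤ thCard L + #A := aleph0_le_thCard.trans (self_le_add_right _ _)
  refine (mk_le_of_injective hinj).trans ?_
  rw [mk_arrow, mk_nat, lift_aleph0, Cardinal.lift_uzero]
  exact (power_le_power_left aleph0_ne_zero hD).trans
    (power_eq_two_power hinf (natCast_le_aleph0 (n := 2)) hinf).le

theorem isInvariantOver_iff [Group G] (hG : IsDefinableGroup L A G) {H : Subgroup G} :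
    IsInvariantOver L A H ↔
      ∀ (σ : C ≃[L] C) (hσ : ∀ a ∈ A, σ a = a), ∀ x ∈ H, autG hG σ hσ x ∈ H := by
  constructor
  · intro h σ hσ x hx
    obtain ⟨y, hy, hyx⟩ := h σ hσ _ ⟨x, hx, rfl⟩
    have : autG hG σ hσ x = y := Subtype.ext hyx.symm
    rwa [this]
  · rintro h σ hσ - ⟨x, hx, rfl⟩
    exact ⟨_, h σ hσ x hx, rfl⟩

theorem isInvariantOver_component [Group G] (hG : IsDefinableGroup L A G) :
    IsInvariantOver L A (component L A G) := by
  rw [isInvariantOver_iff hG]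
  intro σ hσ x hx
  have h : component L A G ≤ (component L A G).comap (autG hG σ hσ).toMonoidHom := by
    refine (Subgroup.closure_le _).2 fun g hg => Subgroup.subset_closure fun P h1 h2 => ?_
    exact (h1.mem_iff_autG hG σ hσ g).1 (hg P h1 h2)
  exact h hx

theorem two_power_lt (hC : IsMonster L κ C) (hA : #A < κ) : 2 ^ (thCard L + #A) < κ :=
  hC.isStrongLimit.isStrongPrelimit (add_lt_of_lt hC.aleph0_le hC.thCard_lt hA)

theorem isG000_component (hC : IsMonster L κ C) [Group G] (hG : IsDefinableGroup L A G)
    (hA : #A < κ) : IsG000 L A (component L A G) := by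
  refine ⟨⟨isInvariantOver_component hG, index_component_le hC hG hA⟩, fun K hK => ?_⟩
  exact (Subgroup.closure_le _).2 (core_subset hC hG hA K (hK.2.trans_lt (two_power_lt hC hA))
    subset_rfl ((isInvariantOver_iff hG).1 hK.1))

/-- Type-definable subgroups are invariant, so minimality is inherited from G⁰⁰⁰. -/
theorem isG00_component (hC : IsMonster L κ C) [Group G] (hG : IsDefinableGroup L A G)
    (hA : #A < κ) (hTD : IsTD L A (component L A G : Set G)) : IsG00 L A (component L A G) := by
  refine ⟨⟨⟨{s | ∃ P : Set G, DefSub L A P ∧ (component L A G : Set G) ⊆ P ∧ s = (↑) '' P},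
    ?_, ?_⟩, index_component_le hC hG hA⟩, fun K hK => ?_⟩
  · rintro _ ⟨P, hP, -, rfl⟩
    exact defSub_iff.1 hP
  · ext w
    constructor
    · rintro ⟨g, hg, rfl⟩ _ ⟨P, -, hP, rfl⟩
      exact ⟨g, hP hg, rfl⟩
    · intro hw
      obtain ⟨g, -, rfl⟩ := hw _ ⟨_, DefSub.univ hG.1, subset_univ _, rfl⟩
      refine ⟨g, hTD g fun P h1 h2 => ?_, rfl⟩
      exact Subtype.val_injective.mem_set_image.1 (hw _ ⟨P, h1, h2, rfl⟩)
  · refine (isG000_component hC hG hA).2 ⟨?_, hK.2⟩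
    obtain ⟨F, hF, hKF⟩ := hK.1
    intro σ hσ x hx
    rw [hKF] at hx ⊢
    exact fun s hs => ((hF s hs).mem_iff_of_equiv σ hσ x).1 (hx s hs)

end Component

/-! ### The structure of translation invariant relations on a definable group -/

section InducedStructure

theorem pullback_id {C : Type*} {k : ℕ} {G : Set (Fin k → C)} {m : ℕ} (R : Set (Fin m → G)) :
    pullback (id : G → G) R = flat '' R := by
  ext w
  constructor
  · rintro ⟨x, hx, hR⟩
    exact ⟨x, hR, funext fun ⟨i, j⟩ => (hx i j).symm⟩
  · rintro ⟨x, hx, rfl⟩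
    exact ⟨x, fun _ _ => rfl, hx⟩

section

variable (L : FirstOrder.Language.{u, v}) {C : Type u'} [L.Structure C] {k : ℕ} (A : Set C)
  (G : Set (Fin k → C)) [Group G]

/-- The relational language whose symbols are the relations on `G` that are definable over `A` and
invariant under right translations. Its structure on `G` makes `G` a torsor without a base point. -/
def torsorLang : FirstOrder.Language.{u', u'} where
  Functions _ := PEmpty
  Relations m := {R : Set (Fin m → G) // DefSet L A R ∧ ∀ x ∈ R, ∀ g : G, (fun i => x i * g) ∈ R}

instance torsorStructure : (torsorLang L A G).Structure G where
  funMap f := PEmpty.elim f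
  RelMap R x := x ∈ R.1

end

variable {L : FirstOrder.Language.{u, v}} {C : Type (max u v)} [L.Structure C] {k : ℕ}
  {G : Set (Fin k → C)} {A B : Set C} {κ : Cardinal.{max u v}} [Group G]

theorem interprets_torsor (hG : A.Definable L G) : Interprets L C (torsorLang L A G) G := by
  refine ⟨k, G, id, hG.mono (subset_univ _), Function.surjective_id, ?_, fun m R => ?_,
    fun m f => f.elim⟩
  · rw [pullback_id]
    exact (DefSet.eq hG 0 1).mono (subset_univ _)
  · rw [pullback_id]
    exact R.2.1.mono (subset_univ _)

theorem thCard_torsorLang_lt (hC : IsMonster L κ C) (hA : #A < κ) :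
    thCard (torsorLang L A G) < κ := by
  have hinf : ℵ₀ ≤ thCard L + #A := aleph0_le_thCard.trans (self_le_add_right _ _)
  refine lt_of_le_of_lt ?_ (add_lt_of_lt hC.aleph0_le hC.thCard_lt hA)
  refine add_le_of_le hinf ?_ hinf
  rw [FirstOrder.Language.card_eq_card_functions_add_card_relations]
  refine add_le_of_le hinf ?_ ?_
  · have : ∀ l, IsEmpty ((torsorLang L A G).Functions l) := fun l => ⟨fun p => p.elim⟩
    simp
  · have h1 : ∀ l, #((torsorLang L A G).Relations l) ≤ thCard L + #A := fun l =>
      (mk_le_of_injective (f := fun R : (torsorLang L A G).Relations l =>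
        (⟨R.1, R.2.1⟩ : {S : Set (Fin l → G) // DefSet L A S}))
        fun R S h => Subtype.ext (show R.1 = S.1 from
          congrArg (fun T : {S : Set (Fin l → G) // DefSet L A S} => T.1) h)).trans (mk_defSet_le _)
    simp only [Cardinal.lift_id]
    refine (Cardinal.sum_le_sum _ (fun _ => thCard L + #A) h1).trans ?_
    rw [Cardinal.sum_const]
    simpa using mul_le_of_le hinf hinf le_rfl

theorem term_defFun (hG : IsDefinableGroup L A G) (D : Set G) {α : Type} [Finite α]
    (t : (torsorLang L A G)[[D]].Term α) :
    DefFun L (A ∪ range (flat ((↑) : D → G))) fun z : α → G => t.realize z := by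
  have hG' := hG.mono (subset_union_left (t := range (flat ((↑) : D → G))))
  induction t with
  | var i => exact DefFun.proj hG'.1 i
  | @func l f ts ih =>
    rcases f with f | f
    · exact f.elim
    · cases l with
      | zero =>
        exact DefFun.const hG'.1 (f : D).1 fun j => Or.inr ⟨((f : D), j), rfl⟩
      | succ l => exact PEmpty.elim f

/-- The torsor has no more definable sets than C induces on G, so it inherits saturation. -/
theorem formula_defSet (hG : IsDefinableGroup L A G) (D : Set G) {α : Type} [Finite α] {n : ℕ}
    (φ : (torsorLang L A G)[[D]].BoundedFormula α n) :
    DefSet L (A ∪ range (flat ((↑) : D → G)))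
      {z : α ⊕ Fin n → G | φ.Realize (z ∘ Sum.inl) (z ∘ Sum.inr)} := by
  have hG' := hG.mono (subset_union_left (t := range (flat ((↑) : D → G))))
  induction φ with
  | falsum =>
    convert! (DefSet.univ (ι := α ⊕ Fin _) hG'.1).compl hG'.1 using 2
    ext
    simp [FirstOrder.Language.BoundedFormula.Realize]
  | equal t₁ t₂ =>
    convert! DefSet.setOf_eq hG'.1 (term_defFun hG D t₁) (term_defFun hG D t₂) using 2
    ext
    simp [FirstOrder.Language.BoundedFormula.Realize]
  | @rel n l R ts =>
    rcases R with R | R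
    · convert! DefSet.preimage hG'.1 (R.2.1.mono subset_union_left)
        (fun i => term_defFun hG D (ts i)) using 2
      ext
      simp only [FirstOrder.Language.BoundedFormula.Realize, Sum.elim_comp_inl_inr]
      rfl
    · exact isEmptyElim R
  | imp φ ψ ih₁ ih₂ =>
    convert! (ih₁.inter (ih₂.compl hG'.1)).compl hG'.1 using 2
    ext
    simp
  | @all n φ ih =>
    let r : α ⊕ Fin (n + 1) → (α ⊕ Fin n) ⊕ Unit := Sum.elim (fun i => Sum.inl (Sum.inl i))
      (Fin.lastCases (Sum.inr ()) fun j => Sum.inl (Sum.inr j))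
    have h := ((ih.compl hG'.1).preimage_comp hG'.1 r).exists.compl hG'.1
    convert! h using 2
    ext z
    simp only [mem_ofPred_eq, FirstOrder.Language.BoundedFormula.realize_all, mem_compl_iff,
      not_exists, not_not]
    have key : ∀ y : Unit → G, (Sum.elim z y ∘ r) ∘ Sum.inr = (Fin.snoc (z ∘ Sum.inr) (y ()) :
        Fin (n + 1) → G) := by
      intro y
      funext j
      refine Fin.lastCases ?_ (fun j => ?_) j <;> simp [r]
    simp only [key]
    exact ⟨fun h y => h (y ()), fun h x => h fun _ => x⟩

end InducedStructure

/-! ### The torsor is a monster model -/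

section TorsorMonster

/-- A permutation preserving all the relations is an automorphism of the torsor structure. -/
def torsorEquiv {L : FirstOrder.Language.{u, v}} {C : Type u'} [L.Structure C] {k : ℕ} {A : Set C}
    {G : Set (Fin k → C)} [Group G] (e : G ≃ G)
    (h : ∀ (m : ℕ) (R : (torsorLang L A G).Relations m) (x : Fin m → G),
      (fun i => e (x i)) ∈ R.1 ↔ x ∈ R.1) : G ≃[torsorLang L A G] G where
  toEquiv := e
  map_fun' f := f.elim
  map_rel' R x := h _ R x

variable {L : FirstOrder.Language.{u, v}} {C : Type (max u v)} [L.Structure C] {k : ℕ}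
  {G : Set (Fin k → C)} {A B : Set C} {κ : Cardinal.{max u v}} [Group G]

theorem translate_mem_iff {m : ℕ} (R : (torsorLang L A G).Relations m) (x : Fin m → G) (g : G) :
    (fun i => x i * g) ∈ R.1 ↔ x ∈ R.1 := by
  refine ⟨fun h => ?_, fun h => R.2.2 x h g⟩
  simpa using R.2.2 _ h g⁻¹

variable (L A) in
/-- Right translation as an automorphism of the torsor structure. -/
def translateEquiv (g : G) : G ≃[torsorLang L A G] G :=
  torsorEquiv (Equiv.mulRight g) fun _ R x => translate_mem_iff R x g

/-- The automorphism of the torsor structure induced by an automorphism fixing the parameters. -/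
noncomputable def inducedEquiv (hG : IsDefinableGroup L A G) (σ : C ≃[L] C)
    (hσ : ∀ a ∈ A, σ a = a) : G ≃[torsorLang L A G] G :=
  torsorEquiv (autG hG σ hσ).toEquiv fun _ R x => (R.2.1.mem_iff_autG hG σ hσ x).symm

theorem mem_iff_of_realize_iff {α : Type*} {a b : α → G}
    (h : ∀ φ : (torsorLang L A G).Formula α, φ.Realize a ↔ φ.Realize b) {m : ℕ}
    (R : (torsorLang L A G).Relations m) (e : Fin m → α) : a ∘ e ∈ R.1 ↔ b ∘ e ∈ R.1 := by
  have := h (R.formula fun i => FirstOrder.Language.Term.var (e i))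
  rw [FirstOrder.Language.Formula.realize_rel, FirstOrder.Language.Formula.realize_rel] at this
  exact this

/-- Quotients by a fixed entry turn A-definable relations into translation invariant ones. Thus the
torsor type of a determines the type over A of the tuple a_i a_{i₀}⁻¹; an automorphism of C moves it
to the corresponding tuple for b, and translations on both sides restore the base entries. -/
theorem isStronglyHomogeneous_torsor (hC : IsMonster L κ C) (hG : IsDefinableGroup L A G)
    (hA : #A < κ) : IsStronglyHomogeneous (torsorLang L A G) κ G := by
  intro α hα a b h
  rcases isEmpty_or_nonempty α with he | ⟨⟨i₀⟩⟩
  · exact ⟨FirstOrder.Language.Equiv.refl _ _, fun i => he.elim i⟩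
  obtain ⟨σ, hσ, hσab⟩ := hC.exists_autG hA hG hα (x := fun i => a i * (a i₀)⁻¹)
    (y := fun i => b i * (b i₀)⁻¹) (by
      intro n e S hS hx
      let R : (torsorLang L A G).Relations (n + 1) :=
        ⟨{z | (fun j : Fin n => z j.succ * (z 0)⁻¹) ∈ S},
          hS.preimage hG.1 fun j => (DefFun.proj hG.1 _).mul hG ((DefFun.proj hG.1 _).inv hG),
          fun x hx g => by simpa [mul_assoc] using hx⟩
      have := (mem_iff_of_realize_iff h R (Fin.cons i₀ e)).1 (by simpa [R] using! hx)
      simpa [R] using! this)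
  refine ⟨(translateEquiv L A (b i₀)).comp
    ((inducedEquiv hG σ hσ).comp (translateEquiv L A (a i₀)⁻¹)), fun i => ?_⟩
  change autG hG σ hσ (a i * (a i₀)⁻¹) * b i₀ = b i
  rw [hσab, inv_mul_cancel_right]

theorem isSaturated_torsor (hC : IsMonster L κ C) (hG : IsDefinableGroup L A G)
    (hA : #A < κ) : IsSaturated (torsorLang L A G) κ G := by
  classical
  intro D hD n p hp
  have hcard : #(A ∪ range (flat ((↑) : D → G)) : Set C) < κ := by
    refine (mk_union_le _ _).trans_lt (add_lt_of_lt hC.aleph0_le hA (mk_range_le.trans_lt ?_))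
    rw [mk_prod]
    refine mul_lt_of_lt hC.aleph0_le (by simpa using hD) ?_
    simpa using (natCast_lt_aleph0 (n := k)).trans_le hC.aleph0_le
  obtain ⟨c, hc⟩ := hC.nonempty_iInter hcard
    (fun φ : p => {z : Fin n → G | φ.1.Realize z}) (by
      intro φ
      have h := (formula_defSet hG D φ.1).preimage_comp
        (hG.1.mono subset_union_left) (Sum.elim id Fin.elim0 : Fin n ⊕ Fin 0 → Fin n)
      convert! h using 2
      ext z
      exact iff_of_eq (congrArg (FirstOrder.Language.BoundedFormula.Realize φ.1 z)
        (Subsingleton.elim _ _))) (by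
      intro s
      obtain ⟨c, hc⟩ := hp (s.image Subtype.val) (by
        intro φ hφ
        obtain ⟨ψ, -, rfl⟩ := Finset.mem_image.1 (Finset.mem_coe.1 hφ)
        exact ψ.2)
      exact ⟨c, fun φ hφ => hc _ (Finset.mem_image_of_mem _ hφ)⟩)
  exact ⟨c, fun φ hφ => hc ⟨φ, hφ⟩⟩

theorem isMonster_torsor (hC : IsMonster L κ C) (hG : IsDefinableGroup L A G)
    (hA : #A < κ) : IsMonster (torsorLang L A G) κ G :=
  ⟨hC.isStrongLimit, thCard_torsorLang_lt hC hA, isSaturated_torsor hC hG hA,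
    isStronglyHomogeneous_torsor hC hG hA⟩

end TorsorMonster

/-! ### Lascar strong types: general facts -/

section LascarGeneral

theorem _root_.Set.Definable.preimage_equiv {L : FirstOrder.Language.{u, v}} {M : Type*}
    [L.Structure M] (f : M ≃[L] M) {B : Set M} {α : Type*} {D : Set (α → M)}
    (hD : (f '' B).Definable L D) : B.Definable L {x | (fun i => f (x i)) ∈ D} := by
  rw [definable_iff_exists_formula_sum] at hD ⊢
  obtain ⟨φ, rfl⟩ := hD
  choose g hg hgf using fun b : f '' B => b.2
  refine ⟨φ.relabel (Sum.map (fun b => (⟨g b, hg b⟩ : B)) id), ?_⟩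
  ext x
  simp only [mem_ofPred_eq, FirstOrder.Language.Formula.realize_relabel]
  refine Iff.trans ?_ (FirstOrder.Language.StrongHomClass.realize_formula f φ)
  refine iff_of_eq (congrArg _ (funext fun i => ?_))
  rcases i with b | i
  · exact (hgf b).symm
  · rfl

/-- This is the Tarski–Vaught test, with definable sets pulled back along f. -/
theorem exists_elementarySubstructure_image {L : FirstOrder.Language.{u, v}} {M : Type*}
    [L.Structure M] (f : M ≃[L] M) (S : L.ElementarySubstructure M) :
    ∃ S' : L.ElementarySubstructure M, (S' : Set M) = f '' S := by
  have h : L.MeetsDefinable (f '' (S : Set M)) := by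
    rintro D ⟨y, hy⟩ hD
    obtain ⟨x, hx, hxS⟩ := S.meetsDefinable (f ⁻¹' D)
      ⟨f.symm y, by simpa [f.apply_symm_apply] using hy⟩ (Set.Definable.preimage_equiv f hD)
    exact ⟨f x, hx, x, hxS, rfl⟩
  exact ⟨h.toElementarySubstructure, h.closure_eq_self⟩

variable {L : FirstOrder.Language.{u, v}} {M : Type (max u v)} [L.Structure M]
  {α : Type (max u v)} {a b c : α → M}

theorem SameTypeOver.mem_iff {B : Set M} (h : SameTypeOver L B a b) {D : Set (α → M)}
    (hD : B.Definable L D) : a ∈ D ↔ b ∈ D := by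
  obtain ⟨φ, rfl⟩ := hD
  exact h φ

theorem LascarDistLE.map {n : ℕ} (h : LascarDistLE L n a b) (f : M ≃[L] M) :
    LascarDistLE L n (fun i => f (a i)) fun i => f (b i) := by
  obtain ⟨c, rfl, rfl, hc⟩ := h
  refine ⟨fun i j => f (c i j), rfl, rfl, fun i hi => ?_⟩
  obtain ⟨S, hS⟩ := hc i hi
  obtain ⟨S', hS'⟩ := exists_elementarySubstructure_image f S
  refine ⟨S', fun φ => ?_⟩
  have hD : (f '' (S : Set M)).Definable L (Set.ofPred φ.Realize) := by
    rw [← hS']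
    exact ⟨φ, rfl⟩
  exact hS.mem_iff (Set.Definable.preimage_equiv f hD)

theorem LascarEquiv.refl (a : α → M) : LascarEquiv L a a :=
  ⟨0, fun _ => a, rfl, rfl, fun i hi => absurd hi (Nat.not_lt_zero i)⟩

theorem LascarEquiv.map (h : LascarEquiv L a b) (f : M ≃[L] M) :
    LascarEquiv L (fun i => f (a i)) fun i => f (b i) :=
  h.imp fun _ h => h.map f

theorem LascarEquiv.symm (h : LascarEquiv L a b) : LascarEquiv L b a := by
  obtain ⟨n, c, rfl, rfl, hc⟩ := h
  refine ⟨n, fun i => c (n - i), by simp, by simp, fun i hi => ?_⟩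
  obtain ⟨S, hS⟩ := hc (n - (i + 1)) (by omega)
  refine ⟨S, fun φ => ?_⟩
  have h1 : n - (i + 1) + 1 = n - i := by omega
  rw [h1] at hS
  exact (hS φ).symm

theorem LascarEquiv.trans (h : LascarEquiv L a b) (h' : LascarEquiv L b c) :
    LascarEquiv L a c := by
  obtain ⟨m, d, rfl, rfl, hd⟩ := h
  obtain ⟨n, e, he, rfl, hn⟩ := h'
  refine ⟨m + n, fun i => if i ≤ m then d i else e (i - m), by simp, ?_, fun i hi => ?_⟩
  · rcases Nat.eq_zero_or_pos n with rfl | hn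
    · simp [he]
    · simp [hn.ne']
  · rcases lt_trichotomy i m with h | rfl | h
    · simpa [h.le, Nat.succ_le_of_lt h] using hd i h
    · simpa [← he] using hn 0 (by omega)
    · have h1 : i + 1 - m = i - m + 1 := by omega
      simpa [h.not_ge, (h.trans (Nat.lt_succ_self i)).not_ge, h1] using hn (i - m) (by omega)

theorem exists_elementarySubstructure_lt {κ : Cardinal.{max u v}} (hκ : thCard L < κ) :
    ∃ S : L.ElementarySubstructure M, #S < κ := by
  rcases le_total (thCard L) #M with h | h
  · obtain ⟨S, -, hS⟩ := L.exists_elementarySubstructure_card_eq (M := M) ∅ (thCard L)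
      aleph0_le_thCard (by simp) (by simp [thCard]) (by simpa using h)
    refine ⟨S, ?_⟩
    rw [Cardinal.lift_id, Cardinal.lift_id] at hS
    rwa [hS]
  · exact ⟨⊤, ((mk_subtype_le _).trans h).trans_lt hκ⟩

theorem IsMonster.exists_sameTypeOver_bound {κ : Cardinal.{max u v}} (hM : IsMonster L κ M)
    {S : Set M} (hS : #S < κ) :
    ∃ (X : Type (max u v)) (f : (PUnit.{max u v + 1} → M) → X), #X < κ ∧
      ∀ a b, f a = f b → SameTypeOver L S a b := by
  refine ⟨Set (L[[S]].Formula PUnit.{max u v + 1}), fun a => {φ | φ.Realize a}, ?_,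
    fun a b h φ => by simpa using congrArg (φ ∈ ·) h⟩
  rw [mk_set]
  refine hM.isStrongLimit.isStrongPrelimit ((mk_formula_le _ _).trans_lt (max_lt ?_ ?_))
  · exact aleph0_le_thCard.trans_lt hM.thCard_lt
  · rw [FirstOrder.Language.card_withConstants]
    refine add_lt_of_lt hM.aleph0_le ?_ ?_
    · simpa using one_lt_aleph0.trans_le hM.aleph0_le
    · simpa using add_lt_of_lt hM.aleph0_le ((self_le_add_right _ _).trans_lt hM.thCard_lt) hS

end LascarGeneral

/-! ### The Lascar strong type of the base point of the torsor -/

section LascarTorsor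

variable {L : FirstOrder.Language.{u, v}} {C : Type (max u v)} [L.Structure C] {k : ℕ}
  {G : Set (Fin k → C)} {A : Set C} {κ : Cardinal.{max u v}} [Group G]

/-- The type of a over S extends to an ultrafilter concentrated on S. Thickness yields z ∈ S with y
z⁻¹ ∈ P for almost all y. This condition is definable over S, so it belongs to the common type of a
and b, and b a⁻¹ = (b z⁻¹)(a z⁻¹)⁻¹. -/
theorem mem_mul_inv_of_sameTypeOver (hG : IsDefinableGroup L A G)
    (S : (torsorLang L A G).ElementarySubstructure G) {a b : PUnit.{max u v + 1} → G}
    (h : SameTypeOver (torsorLang L A G) (S : Set G) a b) {P : Set G} (hP : DefSub L A P)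
    (hPt : Thick P) : b ⟨⟩ * (a ⟨⟩)⁻¹ ∈ P * P⁻¹ := by
  let J := {D : Set G // (S : Set G).Definable₁ (torsorLang L A G) D ∧ a ⟨⟩ ∈ D}
  have hmem : ∀ D : J, b ⟨⟩ ∈ D.1 := by
    intro D
    exact (h.mem_iff (D.2.1.preimage_comp fun _ => PUnit.unit)).1 D.2.2
  have : (⨅ D : J, 𝓟 (D.1 ∩ S)).NeBot := by
    have : Nonempty J := ⟨⟨Set.univ, definable_univ, trivial⟩⟩
    refine iInf_neBot_of_directed' (fun D E => ?_) fun D => ?_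
    · refine ⟨⟨D.1 ∩ E.1, D.2.1.inter E.2.1, D.2.2, E.2.2⟩, ?_, ?_⟩ <;>
      · refine principal_mono.2 fun x hx => ?_
        exact ⟨by first | exact hx.1.1 | exact hx.1.2, hx.2⟩
    · exact principal_neBot_iff.2 (S.meetsDefinable D.1 ⟨_, D.2.2⟩ D.2.1)
  let U := Ultrafilter.of (⨅ D : J, 𝓟 (D.1 ∩ S))
  have hU : ∀ D : J, ∀ᶠ x in U, x ∈ D.1 ∩ S := fun D =>
    Ultrafilter.of_le _ (mem_iInf_of_mem D (mem_principal_self _))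
  have hS := hU ⟨Set.univ, definable_univ, trivial⟩
  obtain ⟨z, hz, -, hzS⟩ := ((hPt U).and hS).exists
  have hdef : (S : Set G).Definable₁ (torsorLang L A G) {y | y * z⁻¹ ∈ P} := by
    let R : (torsorLang L A G).Relations 2 := ⟨{w | w 1 * (w 0)⁻¹ ∈ P},
      hP.preimage hG.1 ((DefFun.proj hG.1 1).mul hG ((DefFun.proj hG.1 0).inv hG)),
      fun x hx g => by simpa [mul_assoc] using hx⟩
    refine definable_iff_exists_formula_sum.2 ⟨R.formula ![FirstOrder.Language.Term.var
      (Sum.inl ⟨z, hzS⟩), FirstOrder.Language.Term.var (Sum.inr 0)], ?_⟩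
    ext y
    simp only [mem_ofPred_eq, FirstOrder.Language.Formula.realize_rel]
    rfl
  have ha : a ⟨⟩ ∈ {y | y * z⁻¹ ∈ P} := by
    by_contra hna
    obtain ⟨y, hy, hy'⟩ := (hz.and (hU ⟨{y | y * z⁻¹ ∈ P}ᶜ, hdef.compl, hna⟩)).exists
    exact hy'.1 hy
  have hb : b ⟨⟩ ∈ {y | y * z⁻¹ ∈ P} := hmem ⟨_, hdef, ha⟩
  exact ⟨_, hb, _, inv_mem_inv.2 ha, by simp⟩

theorem LascarDistLE.mem_pow (hC : IsMonster L κ C) (hG : IsDefinableGroup L A G) (hA : #A < κ)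
    {n : ℕ} {a b : PUnit.{max u v + 1} → G} (h : LascarDistLE (torsorLang L A G) n a b) :
    b ⟨⟩ * (a ⟨⟩)⁻¹ ∈ (core L A G * (core L A G)⁻¹) ^ n := by
  obtain ⟨c, rfl, rfl, hc⟩ := h
  induction n with
  | zero => simp
  | succ n ih =>
    obtain ⟨S, hS⟩ := hc n (Nat.lt_succ_self n)
    rw [pow_succ']
    exact ⟨_, mem_core_mul_inv hC hG hA fun P => mem_mul_inv_of_sameTypeOver hG S hS, _,
      ih fun i hi => hc i (hi.trans (Nat.lt_succ_self n)), by simp⟩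

variable (L G A) in
/-- The group of translations preserving the Lascar strong type of the base point. -/
def lascarGroup : Subgroup G where
  carrier := {h | LascarEquiv (torsorLang L A G) (fun _ : PUnit.{max u v + 1} => (1 : G)) fun _ => h}
  one_mem' := LascarEquiv.refl _
  mul_mem' {g h} hg hh := by
    have := hg.map (translateEquiv L A h)
    refine hh.trans ?_
    convert! this using 2
    exact (one_mul h).symm
  inv_mem' {h} hh := by
    have := hh.map (translateEquiv L A h⁻¹)
    refine LascarEquiv.symm ?_
    convert! this using 2
    · exact (one_mul _).symm
    · exact (mul_inv_cancel h).symm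

/-- Over a small elementary substructure there are few types, and elements of the same type over it
are at Lascar distance at most 1. -/
theorem index_lascarGroup_lt (hC : IsMonster L κ C) (hG : IsDefinableGroup L A G) (hA : #A < κ) :
    #(G ⧸ lascarGroup L G A) < κ := by
  have hN := isMonster_torsor hC hG hA
  obtain ⟨S, hS⟩ := exists_elementarySubstructure_lt (M := G) hN.thCard_lt
  obtain ⟨X, f, hX, hf⟩ := hN.exists_sameTypeOver_bound hS
  refine lt_of_le_of_lt (mk_le_of_injective (f := fun q : G ⧸ lascarGroup L G A =>
    f fun _ => q.out⁻¹) fun q q' h => ?_) hX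
  have h1 : LascarEquiv (torsorLang L A G) (fun _ : PUnit.{max u v + 1} => q'.out⁻¹)
      fun _ => q.out⁻¹ :=
    ⟨1, fun i => if i = 0 then fun _ => q'.out⁻¹ else fun _ => q.out⁻¹, rfl, rfl, fun i hi => by
      obtain rfl : i = 0 := by omega
      exact ⟨S, hf _ _ h.symm⟩⟩
  have h2 := h1.map (translateEquiv L A q'.out)
  rw [← q.out_eq', ← q'.out_eq', QuotientGroup.eq]
  change LascarEquiv _ _ _
  convert! h2 using 2
  exact (inv_mul_cancel _).symm

theorem core_subset_lascarGroup (hC : IsMonster L κ C) (hG : IsDefinableGroup L A G)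
    (hA : #A < κ) : core L A G ⊆ lascarGroup L G A := by
  refine core_subset hC hG hA _ (index_lascarGroup_lt hC hG hA) subset_rfl fun σ hσ x hx => ?_
  have := LascarEquiv.map hx (inducedEquiv hG σ hσ)
  change LascarEquiv _ _ _
  convert! this using 2
  exact (map_one (autG hG σ hσ)).symm

/-- If the torsor is G-compact then the component is type-definable. -/
theorem isTD_component {T : L.Theory} (hT : HereditarilyGCompact T) [Nonempty C] [T.Model C]
    (hC : IsMonster L κ C) (hG : IsDefinableGroup L A G) (hA : #A < κ) :
    IsTD L A (component L A G : Set G) := by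
  obtain ⟨n, hn⟩ := hT C (torsorLang L A G) G (interprets_torsor hG.1) κ G
    (isMonster_torsor hC hG hA) PUnit (by simpa using one_lt_aleph0.trans_le hC.aleph0_le)
    fun _ => 1
  -- G-compactness supplies one n that serves for all elements Lascar equivalent to 1, and these
  -- include the component.
  have h : (component L A G : Set G) = (core L A G * (core L A G)⁻¹) ^ n := by
    refine Subset.antisymm (fun g hg => ?_) fun g hg => ?_
    · have h1 : component L A G ≤ lascarGroup L G A :=
        (Subgroup.closure_le _).2 (core_subset_lascarGroup hC hG hA)
      simpa using (hn _ (h1 hg)).mem_pow hC hG hA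
    · have h2 : core L A G * (core L A G)⁻¹ ⊆ component L A G := by
        rintro _ ⟨a, ha, b, hb, rfl⟩
        exact mul_mem (Subgroup.subset_closure ha)
          (inv_mem_iff.1 (Subgroup.subset_closure hb))
      have h3 : (core L A G * (core L A G)⁻¹) ^ n ⊆ (component L A G : Set G) := by
        clear hn hg
        induction n with
        | zero => simp
        | succ n ih =>
          rw [pow_succ]
          rintro _ ⟨a, ha, b, hb, rfl⟩
          exact mul_mem (ih ha) (h2 hb)
      exact h3 hg
  rw [h]
  exact (isTD_core.mul hC hG hA (isTD_core.inv hG)).pow hC hG hA n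

theorem exists_isG00_and_isG000 {T : L.Theory} (hT : HereditarilyGCompact T) [Nonempty C]
    [T.Model C] (hC : IsMonster L κ C) (hG : IsDefinableGroup L A G) (hA : #A < κ) :
    IsG00 L A (component L A G) ∧ IsG000 L A (component L A G) :=
  ⟨isG00_component hC hG hA (isTD_component hT hC hG hA), isG000_component hC hG hA⟩

end LascarTorsor

/-! ### Shattering by conjugates of a subgroup of small index -/

section Shattering

variable {G Γ : Type u} [Group G] {κ : Cardinal.{u}}

theorem mk_arrow_lt (hκ : κ.IsStrongLimit) (hκ' : ℵ₀ < κ) {I X : Type u} (hI : #I < κ)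
    (hX : #X < κ) : #(I → X) < κ := by
  rw [← power_def]
  calc #X ^ #I ≤ (2 ^ #X) ^ #I := power_le_power_right (cantor _).le
    _ = 2 ^ (#X * #I) := (power_mul).symm
    _ < κ := hκ.isStrongPrelimit (mul_lt_of_lt hκ'.le hX hI)

theorem index_inf_iInf_comap_lt (hκ : κ.IsStrongLimit) (hκ' : ℵ₀ < κ) {H K : Subgroup G}
    (hH : #(G ⧸ H) < κ) (hK : #(G ⧸ K) < κ) {J : Type u} (hJ : #J < κ) (r : J → G →* G) :
    #(G ⧸ (K ⊓ ⨅ j, H.comap (r j))) < κ := by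
  refine lt_of_le_of_lt (mk_le_of_injective (f := fun q : G ⧸ (K ⊓ ⨅ j, H.comap (r j)) =>
    ((q.out : G ⧸ K), fun j => (r j q.out : G ⧸ H))) fun q q' h => ?_)
      (?_ : #((G ⧸ K) × (J → G ⧸ H)) < κ)
  · obtain ⟨h1, h2⟩ := Prod.mk.inj h
    rw [← q.out_eq', ← q'.out_eq', QuotientGroup.eq]
    refine ⟨QuotientGroup.eq.1 h1, Subgroup.mem_iInf.2 fun j => ?_⟩
    have := QuotientGroup.eq.1 (congrFun h2 j)
    simpa using this
  · rw [mk_prod, Cardinal.lift_id, Cardinal.lift_id]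
    exact mul_lt_of_lt hκ'.le hK (mk_arrow_lt hκ hκ' hJ hH)

/-- Induction on n inside an arbitrary K of small index. The factor u ∈ H in the conclusion leaves
room to multiply the old witnesses by an element that the old maps send into H. -/
theorem exists_shattering (hκ : κ.IsStrongLimit) (hκ' : ℵ₀ < κ) {H : Subgroup G}
    (hH : #(G ⧸ H) < κ) {D D₀ : Set G} (hD : ∀ u ∈ H, ∀ d ∈ D₀, ∀ w ∈ H, u * d * w ∈ D)
    (r : Γ → G →* G) (hr : ∀ K : Subgroup G, #(G ⧸ K) < κ → ∃ σ, ∃ c ∈ K, r σ c ∉ D) (n : ℕ) :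
    ∀ K : Subgroup G, #(G ⧸ K) < κ → ∃ (σ : Fin n → Γ) (g : Set (Fin n) → G),
      (∀ S, g S ∈ K) ∧ ∀ S t, (t ∈ S → ∀ u ∈ H, u * r (σ t) (g S) ∉ D₀) ∧
        (t ∉ S → r (σ t) (g S) ∈ H) := by
  classical
  induction n with
  | zero => exact fun K _ => ⟨Fin.elim0, fun _ => 1, fun _ => one_mem K, fun _ t => t.elim0⟩
  | succ n ih =>
    intro K hK
    have hpick : ∀ K' : Subgroup G, ∃ p : Γ × G, #(G ⧸ K') < κ → p.2 ∈ K' ∧ r p.1 p.2 ∉ D := by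
      intro K'
      by_cases h : #(G ⧸ K') < κ
      · obtain ⟨σ, c, hc, hcD⟩ := hr K' h
        exact ⟨(σ, c), fun _ => ⟨hc, hcD⟩⟩
      -- A dummy value; `hr K` only shows that a pair exists.
      · obtain ⟨σ, c, -, -⟩ := hr K hK
        exact ⟨(σ, c), fun h' => absurd h' h⟩
    choose pick hpick using hpick
    let I := (Order.succ (max ℵ₀ #(G ⧸ H))).ord.ToType
    have hI : #I = Order.succ (max ℵ₀ #(G ⧸ H)) := by simp [I]
    have hIκ : #I < κ := by
      rw [hI]
      exact hκ.isSuccLimit.succ_lt (max_lt hκ' hH)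
    -- A long sequence of pairs (σ_i, c_i) with σ_i(c_i) ∉ D, where c_i lies in K and every earlier
    -- σ_j sends it into H.
    let F : ∀ i : I, (∀ j, j < i → Γ × G) → Γ × G := fun i q =>
      pick (K ⊓ ⨅ j : Iio i, H.comap (r (q j.1 j.2).1))
    let q : I → Γ × G := wellFounded_lt.fix F
    have hq : ∀ i, q i = pick (K ⊓ ⨅ j : Iio i, H.comap (r (q j.1).1)) := fun i =>
      wellFounded_lt.fix_eq F i
    have hq' : ∀ i, (q i).2 ∈ K ⊓ ⨅ j : Iio i, H.comap (r (q j.1).1) ∧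
        r (q i).1 (q i).2 ∉ D := by
      intro i
      have := hpick (K ⊓ ⨅ j : Iio i, H.comap (r (q j.1).1))
        (index_inf_iInf_comap_lt hκ hκ' hH hK ((mk_subtype_le _).trans_lt hIκ) _)
      rwa [← hq] at this
    obtain ⟨τ, g, hgK, hg⟩ := ih (K ⊓ ⨅ i, H.comap (r (q i).1))
      (index_inf_iInf_comap_lt hκ hκ' hH hK hIκ _)
    have hcard : #(Fin n → G ⧸ H) < #I := by
      rw [hI, Order.lt_succ_iff]
      rw [mk_arrow, Cardinal.lift_uzero, mk_fin, lift_natCast, power_natCast]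
      exact (pow_le_pow_left' (le_max_right _ _) n).trans
        (power_nat_le (le_max_left _ _))
    obtain ⟨i, i', hne, heq⟩ : ∃ i i' : I, i ≠ i' ∧
        ∀ t, (((r (τ t) (q i).2)⁻¹ : G) : G ⧸ H) = ((r (τ t) (q i').2)⁻¹ : G) := by
      by_contra! hcon
      refine hcard.not_ge (mk_le_of_injective
        (f := fun i t => (((r (τ t) (q i).2)⁻¹ : G) : G ⧸ H)) fun i i' h => ?_)
      by_contra hne
      obtain ⟨t, ht⟩ := hcon i i' hne
      exact ht (congrFun h t)
    wlog hlt : i < i' generalizing i i'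
    · exact this i' i hne.symm (fun t => (heq t).symm) (hne.lt_or_gt.resolve_left hlt)
    -- All old maps send d into H by the choice of i and i', while σ_i sends d into σ_i(c_i) H with
    -- σ_i(c_i) ∉ D. Multiplying by d therefore changes only the new coordinate.
    let d := (q i).2 * (q i').2⁻¹
    have hdτ : ∀ t, r (τ t) d ∈ H := fun t => by
      simpa [d] using QuotientGroup.eq.1 (heq t)
    have hdK : d ∈ K := mul_mem (hq' i).1.1 (inv_mem (hq' i').1.1)
    have hi' : r (q i).1 (q i').2 ∈ H :=
      Subgroup.mem_comap.1 (Subgroup.mem_iInf.1 (hq' i').1.2 ⟨i, hlt⟩)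
    have hgi : ∀ S, r (q i).1 (g S) ∈ H := fun S =>
      Subgroup.mem_comap.1 (Subgroup.mem_iInf.1 (hgK S).2 i)
    refine ⟨Fin.cons (q i).1 τ, fun S => if 0 ∈ S then d * g {t | t.succ ∈ S} else
      g {t | t.succ ∈ S}, fun S => ?_, fun S t => ?_⟩
    · dsimp only
      split_ifs
      · exact mul_mem hdK (hgK _).1
      · exact (hgK _).1
    · beta_reduce
      refine Fin.cases ?_ (fun t => ?_) t
      · refine ⟨fun h u hu hmem => (hq' i).2 ?_, fun h => ?_⟩
        · rw [if_pos h, Fin.cons_zero, map_mul, map_mul, map_inv] at hmem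
          have := hD _ (inv_mem hu) _ hmem _
            (inv_mem (mul_mem (inv_mem hi') (hgi {t | t.succ ∈ S})))
          convert! this using 1
          group
        · rw [if_neg h, Fin.cons_zero]
          exact hgi _
      · have := hg {t | t.succ ∈ S} t
        rw [Fin.cons_succ]
        refine ⟨fun h u hu => ?_, fun h => ?_⟩
        · split_ifs
          · rw [map_mul, ← mul_assoc]
            exact this.1 h _ (mul_mem hu (hdτ t))
          · exact this.1 h u hu
        · split_ifs
          · rw [map_mul]
            exact mul_mem (hdτ t) (this.2 h)
          · exact this.2 h

end Shattering

/-! ### Absoluteness of the component under NIP -/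

section NIP

variable {L : FirstOrder.Language.{u, v}} {C : Type (max u v)} [L.Structure C] {k : ℕ}
  {G : Set (Fin k → C)} {A B : Set C} {κ : Cardinal.{max u v}} [Group G]

/-- Applying σ to g is the same as applying σ⁻¹ to the finitely many parameters defining D₀, so one
formula serves for all n. -/
theorem hasIP_of_shattering (hG : IsDefinableGroup L A G) {D₀ : Set G} (hD₀ : DefSub L B D₀)
    (h : ∀ n, ∃ (σ : Fin n → {σ : C ≃[L] C // ∀ a ∈ A, σ a = a}) (g : Set (Fin n) → G),
      ∀ S t, t ∈ S ↔ autG hG (σ t).1 (σ t).2 (g S) ∉ D₀) :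
    ∃ (m : ℕ) (φ : L.Formula (Fin m ⊕ Fin k)), HasIP C φ := by
  obtain ⟨B₀, -, hB₀⟩ := definable_iff_finitely_definable.1 (defSub_iff.1 hD₀)
  obtain ⟨φ, hφ⟩ := definable_iff_exists_formula_sum.1 hB₀
  let e : (B₀ : Set C) ≃ Fin B₀.card := B₀.equivFin
  refine ⟨B₀.card, (φ.relabel (Sum.map e id)).not, fun n => ?_⟩
  obtain ⟨σ, g, hg⟩ := h n
  refine ⟨fun t j => (σ t).1.symm (e.symm j), fun S => g S, fun t S => ?_⟩
  rw [hg, FirstOrder.Language.Formula.realize_not, FirstOrder.Language.Formula.realize_relabel,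
    not_iff_not, ← Subtype.val_injective.mem_set_image, hφ,
    ← FirstOrder.Language.StrongHomClass.realize_formula (σ t).1 φ]
  refine iff_of_eq (congrArg φ.Realize (funext fun x => ?_))
  rcases x with b | j
  · simp
  · rfl

/-- Only the component over the larger set B is assumed type-definable: it supplies the definable D
separating h from that component, and by compactness a product of three definable neighbourhoods of
it inside D. -/
theorem component_eq_of_subset {T : L.Theory} (hT : NIP T) [Nonempty C] [T.Model C]
    (hC : IsMonster L κ C) (hG : IsDefinableGroup L A G) (hAB : A ⊆ B) (hB : #B < κ)
    (hTD : IsTD L B (component L B G : Set G)) : component L A G = component L B G := by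
  have hA : #A < κ := (mk_le_mk_of_subset hAB).trans_lt hB
  have hGB := hG.mono hAB
  refine le_antisymm ((Subgroup.closure_le _).2 fun h hh => ?_)
    (Subgroup.closure_mono (core_anti hAB))
  by_contra hhB
  obtain ⟨D, hD, hHD, hhD⟩ : ∃ D, DefSub L B D ∧ (component L B G : Set G) ⊆ D ∧ h ∉ D := by
    by_contra! hcon
    exact hhB (hTD h fun P h1 h2 => hcon P h1 h2)
  have hindex : #(G ⧸ component L B G) < κ :=
    (index_component_le hC hGB hB).trans_lt (two_power_lt hC hB)
  obtain ⟨P, hP, hPD⟩ := hC.exists_defSub hGB.1 subset_rfl hB (ι := Fin 3)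
    (fun _ => (component L B G : Set G)) (fun _ => hTD) (R := {x | x 0 * x 1 * x 2 ∈ D})
    (hD.preimage hGB.1 (((DefFun.proj hGB.1 0).mul hGB (DefFun.proj hGB.1 1)).mul hGB
      (DefFun.proj hGB.1 2)))
    fun x hx => hHD (mul_mem (mul_mem (hx 0) (hx 1)) (hx 2))
  let Γ := {σ : C ≃[L] C // ∀ a ∈ A, σ a = a}
  have hsh := exists_shattering hC.isStrongLimit (aleph0_le_thCard.trans_lt hC.thCard_lt) hindex
    (D := D) (D₀ := P 1) (fun u hu d hd w hw => hPD ![u, d, w] fun i => by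
      fin_cases i
      exacts [(hP 0).2 hu, hd, (hP 2).2 hw])
    (fun σ : Γ => (autG hG σ.1 σ.2).toMonoidHom) (by
      intro K hK
      by_contra! hcon
      -- If every A-automorphism kept K inside D, the A-invariant set of elements whose whole orbit
      -- lies in D would contain K, hence h. Here K itself need not be invariant.
      have := core_subset hC hG hA K hK (E := {c | ∀ σ : Γ, autG hG σ.1 σ.2 c ∈ D})
        (fun c hc σ => hcon σ c hc)
        (fun σ hσ x hx τ => hx ⟨τ.1.comp σ, fun a ha => by
          rw [FirstOrder.Language.Equiv.comp_apply, hσ a ha, τ.2 a ha]⟩) hh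
      exact hhD (this ⟨FirstOrder.Language.Equiv.refl L C, fun _ _ => rfl⟩))
  obtain ⟨m, φ, hφ⟩ := hasIP_of_shattering hG (hP 1).1 (fun n => by
    obtain ⟨σ, g, -, hg⟩ := hsh n _ hindex
    refine ⟨σ, g, fun S t => ⟨fun ht => ?_, fun ht => ?_⟩⟩
    · simpa using (hg S t).1 ht 1 (one_mem _)
    · by_contra htS
      exact ht ((hP 1).2 ((hg S t).2 htS)))
  exact hT C m k φ hφ

end NIP

end HGC

/-! ### The proposition -/

theorem mainTheorem4 {L : FirstOrder.Language.{u, v}} (T : L.Theory) (hT : HGC.HereditarilyGCompact T)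
    (κ : Cardinal.{max u v}) (C : Type (max u v)) [L.Structure C] [Nonempty C] [T.Model C]
    (hC : HGC.IsMonster L κ C) {k : ℕ} (G : Set (Fin k → C)) [Group G] :
    (∀ A : Set C, #A < κ → HGC.IsDefinableGroup L A G →
      ∃ H : Subgroup G, HGC.IsG00 L A H ∧ HGC.IsG000 L A H) ∧
    (HGC.NIP T →
      ∃ H : Subgroup G, ∀ A : Set C, #A < κ → HGC.IsDefinableGroup L A G →
        HGC.IsG00 L A H ∧ HGC.IsG000 L A H) := by
  refine ⟨fun A hA hG => ⟨_, HGC.exists_isG00_and_isG000 hT hC hG hA⟩, fun hNIP => ?_⟩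
  by_cases h : ∃ A : Set C, #A < κ ∧ HGC.IsDefinableGroup L A G
  · obtain ⟨A₀, hA₀, hG₀⟩ := h
    refine ⟨HGC.component L A₀ G, fun A hA hG => ?_⟩
    -- Two parameter sets are compared through their union.
    have hU : #(A ∪ A₀ : Set C) < κ :=
      (mk_union_le _ _).trans_lt (add_lt_of_lt hC.aleph0_le hA hA₀)
    have hTD := HGC.isTD_component hT hC (hG.mono Set.subset_union_left) hU
    have h1 := HGC.component_eq_of_subset hNIP hC hG Set.subset_union_left hU hTD
    have h2 := HGC.component_eq_of_subset hNIP hC hG₀ Set.subset_union_right hU hTD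
    rw [h2, ← h1]
    exact HGC.exists_isG00_and_isG000 hT hC hG hA
  · exact ⟨⊤, fun A hA hG => absurd ⟨A, hA, hG⟩ h⟩
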